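/- Let $(\Omega,\mathcal F,\mu)$ be a probability space, $\mathcal H$ a complex Hilbert space and $1<p<2$. A *weight* is an increasing (nondecreasing) real sequence $\{G_n\}_{n\ge1}$ with $G_1\ge1$ and $G_n\to\infty$. For a weight $\{G_n\}$, let $G_{n,1}=G_n+\sum_{k=1}^{n-1}\frac{G_k}{k}$. For a weight $\{V_n\}$, $\mathcal W_p(V_n)$ denotes the set of weights $\{W_n\}$ for which there is a strictly increasing sequence of positive integers $\{m_k\}_{k\ge1}$ such that $$\sum_{k=1}^\infty\Big(\frac{V_{m_k}}{W_{m_k}}\Big)^p<\infty\quad\text{and}\quad\sum_{k=1}^\infty\Big(\frac{m_{k+1}-m_k}{W_{m_k}}\Big)^p<\infty .$$ A *Dunford–Schwartz operator* is a linear contraction $T$ of $L_1(\mu,\mathcal H)$ with $\|Tf\|_\infty\le\|f\|_\infty$ for all $f\in L_1\cap L_\infty$; it acts on $L_p(\mu,\mathcal H)\subset L_1(\mu,\mathcal H)$ by restriction. **Theorem.** Let $\{G_n\}$ be a weight, $\{n_k\}_{k\ge1}$ an increasing (nondecreasing) sequence of nonnegative integers, and $\{a_k\}_{k\ge1}$ a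 bounded sequence of complex numbers such that $$\sup_{n\ge1}\max_{|\lambda|=1}\Big|\frac1{G_n}\sum_{k=1}^n a_k\lambda^{n_k}\Big|<\infty .$$ Let $\{W_n\}\in\mathcal W_p(G_{n,1})$ satisfy $$\sum_{n=1}^\infty\frac{G_{n,1}}{W_n}\Big|1-\frac{W_n}{W_{n+1}}\Big|<\infty,$$ and let $\beta>0$ be such that $\sum_{k=1}^\infty\frac1{k^\beta W_k}<\infty$. Put $t=\frac{2-p}{p}$. Then for every Dunford–Schwartz operator $T$ and every $f\in L_p(\mu,\mathcal H)$ the series $$\sum_{k=1}^\infty\frac{a_k\,T^{n_k}f}{k^{\beta t}W_k}$$ converges almost everywhere in the norm of $\mathcal H$, and $$\sup_{n\ge1}\Big\|\sum_{k=1}^n\frac{a_k\,T^{n_k}f}{k^{\beta t}W_k}\Big\|_{\mathcal H}\in L_p(\mu).$$ -/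

import Mathlib

open MeasureTheory Filter Topology
open scoped ENNReal

namespace ErgodicHilbert

/- Sequences are functions on `ℕ` of which only the terms with index `≥ 1` are used. -/

/-- A weight: an increasing sequence `G_1 ≤ G_2 ≤ …` with `G_1 ≥ 1` and `G_n → ∞`. -/
structure IsWeight (G : ℕ → ℝ) : Prop where
  monotone : MonotoneOn G (Set.Ici 1)
  one_le : 1 ≤ G 1
  tendsto : Tendsto G atTop atTop

/-- `{W_n}` is a `p`-admissible weight with respect to `{G_n}`, that is, `W ∈ 𝒲_p(G_n)`.
The subsequence of indices is `m 0 < m 1 < …` with `m 0 ≥ 1`. -/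
structure IsAdmissible (p : ℝ) (G W : ℕ → ℝ) : Prop where
  isWeight : IsWeight W
  exists_subseq : ∃ m : ℕ → ℕ, StrictMono m ∧ 1 ≤ m 0 ∧
    Summable (fun k : ℕ => (G (m k) / W (m k)) ^ p) ∧
    Summable (fun k : ℕ => (((m (k + 1) : ℝ) - (m k : ℝ)) / W (m k)) ^ p)

/-- `G_{n,r} = G_n / |r| + ∑_{k=1}^{n-1} G_k / k` (for `r ≠ 0`). -/
noncomputable def modWeight (G : ℕ → ℝ) (r : ℝ) (n : ℕ) : ℝ :=
  1 / |r| * G n + ∑ k ∈ Finset.Ico 1 n, G k / (k : ℝ)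

section Operators

variable {Ω : Type*} [MeasurableSpace Ω] {μ : Measure Ω}
  {H : Type*} [NormedAddCommGroup H] [InnerProductSpace ℂ H]

/-- A Dunford–Schwartz operator: a linear contraction of `L_1(μ, H)` with
`‖T f‖_∞ ≤ ‖f‖_∞` for all `f ∈ L_1 ∩ L_∞`. -/
structure IsDunfordSchwartz (T : Lp H 1 μ →L[ℂ] Lp H 1 μ) : Prop where
  contraction : ∀ f : Lp H 1 μ, ‖T f‖ ≤ ‖f‖
  contraction_top : ∀ f : Lp H 1 μ, MemLp f ∞ μ → eLpNorm (T f) ∞ μ ≤ eLpNorm f ∞ μ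

/-- The partial sum `∑_{k=1}^N (a_k / c_k) T^{n_k} f`, as a function on `Ω`. -/
noncomputable def hilbertSum (a : ℕ → ℂ) (c : ℕ → ℝ) (n : ℕ → ℕ)
    (T : Lp H 1 μ →L[ℂ] Lp H 1 μ) (f : Lp H 1 μ) (N : ℕ) (x : Ω) : H :=
  ∑ k ∈ Finset.Icc 1 N, (a k / (c k : ℂ)) • ((T ^ n k) f : Lp H 1 μ) x

end Operators

end ErgodicHilbert

/-! The proof is Stein's complex interpolation applied to maximal functions of the analytic family
`P_N(z) = e^{z² - t²} ∑_{k ≤ N} k^{-βz} a_k W_k⁻¹ T^{n_k}`, whose value at `z = t` is the `N`-th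
partial sum of the series.

On `Re z = 1` the coefficients are dominated by a multiple of `k^{-β} / W_k`, which is summable, so
the maximal function is bounded on `L_1` by the triangle inequality
(`IsDunfordSchwartz.lintegral_maxFn_le`). On `Re z = 0` the factor `k^{-βz}` is unimodular.
Summation by parts bounds the modulated exponential sums by `(1 + β|Im z|) G_{N,1}`, and `e^{z²}`
absorbs the growth in `Im z`. Since `T` contracts `L_2`, von Neumann's inequality converts this into
`L_2` norms of operator sums. Summation by parts against `1/W` and a decomposition into blocks
`[m_k, m_{k+1})` then yield an `L_2` maximal inequality uniform in `z` (`exists_maximal_two`).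
Interpolating between `1/2` and `1` reaches `1/p = (1-t)/2 + t`, that is `t = (2-p)/p`
(`stein_simple`, `exists_maximal_Lp`).

For convergence, on `L_2` the sums without the factor `k^{-βt}` are already bounded almost
everywhere, so Dirichlet's test applies (`ae_cauchySeq_of_memLp_two`). Banach's principle carries
convergence from simple functions to `L_p` (`ae_cauchySeq_of_maximal`). -/

namespace ErgodicHilbert

/-! ### Von Neumann's inequality for contractions of an inner product space, by finite Fourier
analysis. -/

section VonNeumann

variable {E : Type*} [NormedAddCommGroup E] [InnerProductSpace ℂ E]

open ZMod (dft stdAddChar isPrimitive_stdAddChar dft_apply)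

/-- Parseval's identity for the discrete Fourier transform. -/
lemma sum_norm_sq_dft {L : ℕ} [NeZero L] (z : ZMod L → E) :
    ∑ j, ‖dft z j‖ ^ 2 = L * ∑ m, ‖z m‖ ^ 2 := by
  have key : ∑ j, inner ℂ (dft z j) (dft z j) = (L : ℂ) * ∑ m, inner ℂ (z m) (z m) := by
    have h1 : ∀ j, inner ℂ (dft z j) (dft z j) =
        ∑ m, ∑ m', stdAddChar (j * (m - m')) * inner ℂ (z m) (z m') := by
      intro j
      rw [dft_apply, sum_inner]
      refine Finset.sum_congr rfl fun m _ => ?_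
      rw [inner_sum]
      refine Finset.sum_congr rfl fun m' _ => ?_
      rw [inner_smul_left, inner_smul_right, ← mul_assoc, ← AddChar.map_neg_eq_conj,
        ← AddChar.map_add_eq_mul]
      congr 2
      ring
    simp_rw [h1]
    rw [Finset.sum_comm, Finset.mul_sum]
    refine Finset.sum_congr rfl fun m _ => ?_
    rw [Finset.sum_comm]
    simp_rw [← Finset.sum_mul, AddChar.sum_mulShift _ (isPrimitive_stdAddChar L), sub_eq_zero]
    simp [ZMod.card]
  apply Complex.ofReal_injective
  push_cast
  simpa [inner_self_eq_norm_sq_to_K] using key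

/-- The quadratic form `‖·‖² - ‖T ·‖²` of a contraction under a Fourier multiplier of `ZMod L`. -/
lemma sum_defect_le {L : ℕ} [NeZero L] (T : E →ₗ[ℂ] E) (hT : ∀ x, ‖T x‖ ≤ ‖x‖)
    (x y : ZMod L → E) (q : ZMod L → ℂ) (Q : ℝ) (hq : ∀ j, ‖q j‖ ≤ Q)
    (h : ∀ j, dft y j = q j • dft x j) :
    ∑ m, (‖y m‖ ^ 2 - ‖T (y m)‖ ^ 2) ≤ Q ^ 2 * ∑ m, (‖x m‖ ^ 2 - ‖T (x m)‖ ^ 2) := by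
  have hL : (0 : ℝ) < L := by exact_mod_cast Nat.pos_of_ne_zero (NeZero.ne L)
  have hTd : ∀ z : ZMod L → E, ∀ j, dft (fun m => T (z m)) j = T (dft z j) := by
    intro z j
    simp [dft_apply, map_sum]
  have hd : ∀ z : ZMod L → E, L * ∑ m, (‖z m‖ ^ 2 - ‖T (z m)‖ ^ 2) =
      ∑ j, (‖dft z j‖ ^ 2 - ‖T (dft z j)‖ ^ 2) := by
    intro z
    rw [Finset.sum_sub_distrib, Finset.sum_sub_distrib, mul_sub, ← sum_norm_sq_dft,
      ← sum_norm_sq_dft]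
    simp_rw [hTd]
  refine le_of_mul_le_mul_left ?_ hL
  rw [mul_left_comm, hd, hd, Finset.mul_sum]
  refine Finset.sum_le_sum fun j _ => ?_
  rw [h, map_smul, norm_smul, norm_smul]
  have h1 : ‖q j‖ ^ 2 ≤ Q ^ 2 := pow_le_pow_left₀ (norm_nonneg _) (hq j) 2
  have h2 : ‖T (dft x j)‖ ^ 2 ≤ ‖dft x j‖ ^ 2 := pow_le_pow_left₀ (norm_nonneg _) (hT _) 2
  nlinarith

lemma norm_pow_apply_le (T : E →ₗ[ℂ] E) {r : ℝ} (hr : 0 ≤ r) (hT : ∀ x, ‖T x‖ ≤ r * ‖x‖)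
    (k : ℕ) (x : E) : ‖(T ^ k) x‖ ≤ r ^ k * ‖x‖ := by
  induction k with
  | zero => simp
  | succ k ih =>
    rw [pow_succ', Module.End.mul_apply, pow_succ', mul_assoc]
    exact (hT _).trans (mul_le_mul_of_nonneg_left ih hr)

/-- On the orbit `m ↦ T^m x`, laid out on `ZMod L`, the polynomial in `T` acts (up to wrap-around)
as a Fourier multiplier whose symbol is the given exponential sum at roots of unity. Hence it
enlarges the total defect by at most `Q²`, and defects along an orbit telescope. Neither a dilation
nor an adjoint is involved, so completeness is not needed. -/
lemma von_neumann_defect (T : E →ₗ[ℂ] E) (hT : ∀ x, ‖T x‖ ≤ ‖x‖)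
    (s : Finset ℕ) (c : ℕ → ℂ) (n : ℕ → ℕ) (Q : ℝ)
    (hQ : ∀ z : ℂ, ‖z‖ = 1 → ‖∑ k ∈ s, c k * z ^ n k‖ ≤ Q) (x : E) (M : ℕ) :
    ‖∑ k ∈ s, c k • (T ^ n k) x‖ ^ 2 - ‖(T ^ M) (∑ k ∈ s, c k • (T ^ n k) x)‖ ^ 2
      ≤ Q ^ 2 * ‖x‖ ^ 2 := by
  set y := ∑ k ∈ s, c k • (T ^ n k) x with hy
  set d := s.sup n
  have hd : ∀ k ∈ s, n k ≤ d := fun k hk => Finset.le_sup hk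
  -- Large enough that for `m < M` the shifts `m + n k ≤ m + d` do not wrap around, so that `Y m =
  -- T^m y` there.
  set L := M + d + 1 with hL
  have : NeZero L := ⟨by omega⟩
  let X : ZMod L → E := fun m => (T ^ m.val) x
  let Y : ZMod L → E := fun m => ∑ k ∈ s, c k • X (m + (n k : ZMod L))
  have hdft : ∀ j, dft Y j = (∑ k ∈ s, c k * (stdAddChar j : ℂ) ^ n k) • dft X j := by
    intro j
    simp only [dft_apply, Y, Finset.smul_sum, Finset.sum_smul]
    rw [Finset.sum_comm, Finset.sum_comm (s := Finset.univ) (t := s)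
      (f := fun m k => (c k * (stdAddChar j : ℂ) ^ n k) • stdAddChar (-(m * j)) • X m)]
    refine Finset.sum_congr rfl fun k _ => ?_
    refine Fintype.sum_equiv (Equiv.addRight (n k : ZMod L)) _ _ fun m => ?_
    simp only [Equiv.coe_addRight, smul_smul]
    congr 1
    have : (stdAddChar j : ℂ) ^ n k = stdAddChar ((n k : ZMod L) * j) := by
      rw [← AddChar.map_nsmul_eq_pow, nsmul_eq_mul]
    rw [this, mul_assoc, ← AddChar.map_add_eq_mul, mul_comm]
    congr 2
    ring
  have main := sum_defect_le T hT X Y _ Q (fun j => hQ _ (by simp)) hdft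
  have tel : ∀ (u : E) (N : ℕ), ∑ m ∈ Finset.range N, (‖(T ^ m) u‖ ^ 2 - ‖T ((T ^ m) u)‖ ^ 2) =
      ‖u‖ ^ 2 - ‖(T ^ N) u‖ ^ 2 := by
    intro u N
    have := Finset.sum_range_sub' (fun m => ‖(T ^ m) u‖ ^ 2) N
    simpa [pow_succ'] using this
  have sumval : ∀ g : ℕ → ℝ, ∑ m : ZMod L, g m.val = ∑ m ∈ Finset.range L, g m := by
    intro g
    exact Fin.sum_univ_eq_sum_range g L
  have hX : ∑ m, (‖X m‖ ^ 2 - ‖T (X m)‖ ^ 2) = ‖x‖ ^ 2 - ‖(T ^ L) x‖ ^ 2 := by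
    rw [← tel]
    exact sumval (fun m => ‖(T ^ m) x‖ ^ 2 - ‖T ((T ^ m) x)‖ ^ 2)
  have hYlow : ‖y‖ ^ 2 - ‖(T ^ M) y‖ ^ 2 ≤ ∑ m, (‖Y m‖ ^ 2 - ‖T (Y m)‖ ^ 2) := by
    -- The indices `m ≥ M`, where wrap-around may occur, contribute nonnegative defects and can be
    -- dropped.
    have hnn : ∀ m, 0 ≤ ‖Y m‖ ^ 2 - ‖T (Y m)‖ ^ 2 := fun m =>
      sub_nonneg.2 (pow_le_pow_left₀ (norm_nonneg _) (hT _) 2)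
    have e : ∀ m ∈ Finset.range M, Y (m : ZMod L) = (T ^ m) y := by
      intro m hm
      rw [Finset.mem_range] at hm
      simp only [Y, X, hy, map_sum, map_smul]
      refine Finset.sum_congr rfl fun k hk => ?_
      have := hd k hk
      rw [← Nat.cast_add, ZMod.val_cast_of_lt (by omega), pow_add, Module.End.mul_apply]
    rw [← tel]
    calc _ = ∑ m ∈ Finset.range M, (‖Y (m : ZMod L)‖ ^ 2 - ‖T (Y (m : ZMod L))‖ ^ 2) :=
          Finset.sum_congr rfl fun m hm => by rw [e m hm]
      _ ≤ ∑ m ∈ Finset.range L, (‖Y (m : ZMod L)‖ ^ 2 - ‖T (Y (m : ZMod L))‖ ^ 2) :=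
          Finset.sum_le_sum_of_subset_of_nonneg (Finset.range_mono (by omega))
            fun m _ _ => hnn _
      _ = _ := by
          rw [← sumval]
          simp
  nlinarith [sq_nonneg (Q * ‖(T ^ L) x‖)]

/-- Von Neumann's inequality. -/
theorem von_neumann (T : E →ₗ[ℂ] E) (hT : ∀ x, ‖T x‖ ≤ ‖x‖)
    (s : Finset ℕ) (c : ℕ → ℂ) (n : ℕ → ℕ) (Q : ℝ)
    (hQ : ∀ z : ℂ, ‖z‖ = 1 → ‖∑ k ∈ s, c k * z ^ n k‖ ≤ Q) (x : E) :
    ‖∑ k ∈ s, c k • (T ^ n k) x‖ ≤ Q * ‖x‖ := by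
  have hQ0 : 0 ≤ Q := (norm_nonneg _).trans (hQ 1 (by simp))
  -- For `rT` with `r < 1` the term `(rT)^M y` vanishes as `M → ∞`, so the defect becomes the full
  -- norm; then `r → 1`.
  have strict : ∀ r : ℝ, 0 ≤ r → r < 1 →
      ‖∑ k ∈ s, c k • (((r : ℂ) • T) ^ n k) x‖ ≤ Q * ‖x‖ := by
    intro r hr0 hr1
    have hrT : ∀ x, ‖((r : ℂ) • T) x‖ ≤ r * ‖x‖ := fun x => by
      rw [LinearMap.smul_apply, norm_smul, Complex.norm_real, Real.norm_of_nonneg hr0]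
      exact mul_le_mul_of_nonneg_left (hT x) hr0
    have hrT' : ∀ x, ‖((r : ℂ) • T) x‖ ≤ ‖x‖ := fun x =>
      (hrT x).trans (mul_le_of_le_one_left (norm_nonneg _) hr1.le)
    set y := ∑ k ∈ s, c k • (((r : ℂ) • T) ^ n k) x with hy
    have hlim : Tendsto (fun M : ℕ => ‖y‖ ^ 2 - (r ^ M * ‖y‖) ^ 2) atTop
        (𝓝 (‖y‖ ^ 2 - (0 * ‖y‖) ^ 2)) :=
      (((tendsto_pow_atTop_nhds_zero_of_lt_one hr0 hr1).mul_const _).pow 2).const_sub _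
    have hle : ‖y‖ ^ 2 - (0 * ‖y‖) ^ 2 ≤ Q ^ 2 * ‖x‖ ^ 2 := by
      refine le_of_tendsto' hlim fun M => ?_
      refine le_trans ?_ (von_neumann_defect _ hrT' s c n Q hQ x M)
      rw [← hy]
      have := pow_le_pow_left₀ (norm_nonneg _) (norm_pow_apply_le _ hr0 hrT M y) 2
      linarith
    refine le_of_sq_le_sq ?_ (by positivity)
    nlinarith
  have hcont : Continuous fun r : ℝ => ‖∑ k ∈ s, c k • (((r : ℂ) • T) ^ n k) x‖ := by
    simp_rw [smul_pow, LinearMap.smul_apply]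
    fun_prop
  have hlim : Tendsto (fun r : ℝ => ‖∑ k ∈ s, c k • (((r : ℂ) • T) ^ n k) x‖) (𝓝[<] 1)
      (𝓝 ‖∑ k ∈ s, c k • (T ^ n k) x‖) := by
    have := (hcont.tendsto 1).mono_left (nhdsWithin_le_nhds (s := Set.Iio 1))
    simpa using this
  refine le_of_tendsto hlim ?_
  have h0 : ∀ᶠ r : ℝ in 𝓝[<] 1, 0 ≤ r :=
    nhdsWithin_le_nhds (eventually_ge_nhds zero_lt_one)
  filter_upwards [h0, self_mem_nhdsWithin] with r hr0 hr1 using strict r hr0 hr1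

end VonNeumann

/-! ### Linearized maximal functions, powers of simple functions, and bounded entire families on the
strip. -/

section Interpolation

open scoped NNReal

variable {Ω : Type*} [MeasurableSpace Ω] {μ : Measure Ω}
  {H : Type*} [NormedAddCommGroup H] [InnerProductSpace ℂ H]

/-- Measurable linearization of a finite maximal function. -/
lemma exists_linearization (R : Finset ℕ) (u : ℕ → Ω → H) (hu : ∀ N, StronglyMeasurable (u N)) :
    ∃ (s : ℕ → Ω → H) (m : Ω → ℝ), (∀ N, StronglyMeasurable (s N)) ∧ (∀ N x, ‖s N x‖ ≤ 1) ∧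
      (∀ x, ∑ N ∈ R, ‖s N x‖ₑ ≤ 1) ∧ Measurable m ∧ (∀ x, 0 ≤ m x) ∧
      (∀ x, ENNReal.ofReal (m x) = ⨆ N ∈ R, ‖u N x‖ₑ) ∧
      ∀ x, ∑ N ∈ R, inner ℂ (s N x) (u N x) = (m x : ℂ) := by
  classical
  induction R using Finset.induction_on with
  | empty =>
    exact ⟨fun _ _ => 0, fun _ => 0, fun _ => stronglyMeasurable_const, by simp, by simp,
      measurable_const, by simp, by simp, by simp⟩
  | insert M R hM ih =>
    obtain ⟨s, m, hs, hs1, hsum, hm, hm0, hmsup, hin⟩ := ih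
    -- Where the new index strictly beats the old maximum, the selectors are replaced by `sgn u_M`
    -- alone; elsewhere they are kept. At each point at most one selector is nonzero.
    set E : Set Ω := {x | m x < ‖u M x‖} with hE
    have hEm : MeasurableSet E := measurableSet_lt hm (hu M).norm.measurable
    have hsgn : StronglyMeasurable fun x => ((‖u M x‖⁻¹ : ℝ) : ℂ) • u M x :=
      (Complex.measurable_ofReal.comp (hu M).norm.measurable.inv).stronglyMeasurable.smul (hu M)
    have hsgn1 : ∀ x, ‖((‖u M x‖⁻¹ : ℝ) : ℂ) • u M x‖ ≤ 1 := fun x => by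
      rw [norm_smul, Complex.norm_real, norm_inv, norm_norm]
      exact inv_mul_le_one
    obtain ⟨s', hsM, hsN⟩ : ∃ s' : ℕ → Ω → H,
        s' M = E.indicator (fun x => ((‖u M x‖⁻¹ : ℝ) : ℂ) • u M x) ∧
        ∀ N, N ≠ M → s' N = Eᶜ.indicator (s N) :=
      ⟨fun N => if N = M then E.indicator (fun x => ((‖u M x‖⁻¹ : ℝ) : ℂ) • u M x)
        else Eᶜ.indicator (s N), if_pos rfl, fun N hN => if_neg hN⟩
    refine ⟨s', fun x => max (m x) ‖u M x‖, ?_, ?_, ?_, ?_, ?_, ?_, ?_⟩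
    · intro N
      by_cases h : N = M
      · rw [h, hsM]
        exact hsgn.indicator hEm
      · rw [hsN N h]
        exact (hs N).indicator hEm.compl
    · intro N x
      by_cases h : N = M
      · rw [h, hsM]
        exact (norm_indicator_le_norm_self _ _).trans (hsgn1 x)
      · rw [hsN N h]
        exact (norm_indicator_le_norm_self _ _).trans (hs1 N x)
    · intro x
      rw [Finset.sum_insert hM]
      have e : ∀ N ∈ R, N ≠ M := fun N hN h => hM (h ▸ hN)
      rw [Finset.sum_congr rfl fun N hN => by rw [hsN N (e N hN)], hsM]
      by_cases hx : x ∈ E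
      · have : x ∉ Eᶜ := fun h => h hx
        simp only [Set.indicator_of_mem hx, Set.indicator_of_notMem this, enorm_zero,
          Finset.sum_const_zero, add_zero]
        rw [← ofReal_norm]
        simpa using ENNReal.ofReal_le_ofReal (hsgn1 x)
      · have : x ∈ Eᶜ := hx
        simp only [Set.indicator_of_mem this, Set.indicator_of_notMem hx, enorm_zero, zero_add]
        exact hsum x
    · exact hm.max (hu M).norm.measurable
    · exact fun x => le_max_of_le_left (hm0 x)
    · intro x
      rw [Finset.iSup_insert, ← hmsup, ← ofReal_norm, ENNReal.ofReal_max, sup_comm]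
    · intro x
      rw [Finset.sum_insert hM]
      have e : ∀ N ∈ R, N ≠ M := fun N hN h => hM (h ▸ hN)
      rw [Finset.sum_congr rfl fun N hN => by rw [hsN N (e N hN)], hsM]
      by_cases hx : x ∈ E
      · have : x ∉ Eᶜ := fun h => h hx
        simp only [Set.indicator_of_mem hx, Set.indicator_of_notMem this, inner_zero_left,
          Finset.sum_const_zero, add_zero, max_eq_right (le_of_lt (show m x < ‖u M x‖ from hx))]
        have hne : (‖u M x‖ : ℂ) ≠ 0 := by exact_mod_cast ((hm0 x).trans_lt hx).ne'
        rw [inner_smul_left, inner_self_eq_norm_sq_to_K, Complex.conj_ofReal, Complex.ofReal_inv]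
        exact (by field_simp : (‖u M x‖ : ℂ)⁻¹ * (‖u M x‖ : ℂ) ^ 2 = ‖u M x‖)
      · have : x ∈ Eᶜ := hx
        simp only [Set.indicator_of_mem this, Set.indicator_of_notMem hx, inner_zero_left,
          zero_add, max_eq_left (not_lt.1 (show ¬ m x < ‖u M x‖ from hx))]
        exact hin x

lemma integrable_inner_Lp {s : Ω → H} (hs : StronglyMeasurable s) (hs1 : ∀ x, ‖s x‖ ≤ 1)
    (g : Lp H 1 μ) : Integrable (fun x => inner ℂ (s x) (g x)) μ := by
  refine (L1.integrable_coeFn g).mono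
    (hs.aestronglyMeasurable.inner (Lp.aestronglyMeasurable g)) (ae_of_all _ fun x => ?_)
  exact (norm_inner_le_norm _ _).trans (mul_le_of_le_one_left (norm_nonneg _) (hs1 x))

/-- The functional `g ↦ ∫ ⟪s, g⟫` on `L_1` given by a function `s` with `‖s‖ ≤ 1`. -/
noncomputable def pairing (s : Ω → H) (hs : StronglyMeasurable s) (hs1 : ∀ x, ‖s x‖ ≤ 1) :
    Lp H 1 μ →L[ℂ] ℂ :=
  LinearMap.mkContinuous
    { toFun := fun g => ∫ x, inner ℂ (s x) (g x) ∂μ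
      map_add' := fun g h => by
        rw [← integral_add (integrable_inner_Lp hs hs1 g) (integrable_inner_Lp hs hs1 h)]
        refine integral_congr_ae ?_
        filter_upwards [Lp.coeFn_add g h] with x hx
        rw [hx, Pi.add_apply, inner_add_right]
      map_smul' := fun c g => by
        rw [RingHom.id_apply, smul_eq_mul, ← integral_const_mul]
        refine integral_congr_ae ?_
        filter_upwards [Lp.coeFn_smul c g] with x hx
        rw [hx, Pi.smul_apply, inner_smul_right] }
    1 fun g => by
      rw [one_mul, L1.norm_eq_integral_norm]
      refine (norm_integral_le_integral_norm _).trans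
        (integral_mono (integrable_inner_Lp hs hs1 g).norm (L1.integrable_coeFn g).norm fun x => ?_)
      exact (norm_inner_le_norm _ _).trans (mul_le_of_le_one_left (norm_nonneg _) (hs1 x))

lemma pairing_apply (s : Ω → H) (hs : StronglyMeasurable s) (hs1 : ∀ x, ‖s x‖ ≤ 1)
    (g : Lp H 1 μ) : pairing s hs hs1 g = ∫ x, inner ℂ (s x) (g x) ∂μ := rfl

variable [IsFiniteMeasure μ]

/-- The class in `L_1` of a simple function. -/
noncomputable def simpleLp (μ : Measure Ω) [IsFiniteMeasure μ] (f : SimpleFunc Ω H) : Lp H 1 μ :=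
  (f.memLp_of_isFiniteMeasure 1 μ).toLp f

omit [InnerProductSpace ℂ H] in
lemma coeFn_simpleLp (f : SimpleFunc Ω H) : simpleLp μ f =ᵐ[μ] f := MemLp.coeFn_toLp _

/-- `|f|^α sgn f` -/
noncomputable def powSimple (f : SimpleFunc Ω H) (α : ℂ) : SimpleFunc Ω H :=
  f.map fun v => (‖v‖ : ℂ) ^ (α - 1) • v

lemma enorm_powSimple_le (f : SimpleFunc Ω H) (α : ℂ) (x : Ω) :
    ‖powSimple f α x‖ₑ ≤ ‖f x‖ₑ ^ α.re := by
  rw [powSimple, SimpleFunc.map_apply]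
  by_cases h : f x = 0
  · simp [h]
  · have h0 : 0 < ‖f x‖ := norm_pos_iff.2 h
    rw [← ofReal_norm, ← ofReal_norm, norm_smul, Complex.norm_cpow_eq_rpow_re_of_pos h0,
      ENNReal.ofReal_rpow_of_pos h0]
    refine ENNReal.ofReal_le_ofReal (le_of_eq ?_)
    rw [Complex.sub_re, Complex.one_re, Real.rpow_sub_one h0.ne']
    field_simp

lemma powSimple_one (f : SimpleFunc Ω H) : powSimple f 1 = f := by
  ext x
  simp [powSimple]

/-- `c ↦ c(f) f` as a linear map into `L_1`. -/
noncomputable def weightedSimple (μ : Measure Ω) [IsFiniteMeasure μ] (f : SimpleFunc Ω H) :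
    (H → ℂ) →ₗ[ℂ] Lp H 1 μ where
  toFun c := simpleLp μ (f.map fun v => c v • v)
  map_add' c d := by
    refine Lp.ext ?_
    filter_upwards [coeFn_simpleLp (μ := μ) (f.map fun v => (c + d) v • v),
      coeFn_simpleLp (μ := μ) (f.map fun v => c v • v),
      coeFn_simpleLp (μ := μ) (f.map fun v => d v • v),
      Lp.coeFn_add (simpleLp μ (f.map fun v => c v • v)) (simpleLp μ (f.map fun v => d v • v))]
      with x h1 h2 h3 h4
    rw [h4, Pi.add_apply, h1, h2, h3]
    simp [add_smul]
  map_smul' r c := by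
    refine Lp.ext ?_
    filter_upwards [coeFn_simpleLp (μ := μ) (f.map fun v => (r • c) v • v),
      coeFn_simpleLp (μ := μ) (f.map fun v => c v • v),
      Lp.coeFn_smul r (simpleLp μ (f.map fun v => c v • v))] with x h1 h2 h3
    rw [RingHom.id_apply, h3, Pi.smul_apply, h1, h2]
    simp [mul_smul]

lemma weightedSimple_congr (f : SimpleFunc Ω H) {c d : H → ℂ}
    (h : ∀ v ∈ f.range, c v • v = d v • v) : weightedSimple μ f c = weightedSimple μ f d := by
  have : (f.map fun v => c v • v) = f.map fun v => d v • v := by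
    ext x
    exact h _ (f.mem_range_self x)
  simp [weightedSimple, this]

/-- A function that is entire and bounded on the strip `0 ≤ Re z ≤ 1`. -/
structure StripBounded {E : Type*} [NormedAddCommGroup E] [NormedSpace ℂ E] (F : ℂ → E) :
    Prop where
  differentiable : Differentiable ℂ F
  bounded : ∃ B : ℝ, ∀ z : ℂ, z.re ∈ Set.Icc (0 : ℝ) 1 → ‖F z‖ ≤ B

namespace StripBounded

variable {E : Type*} [NormedAddCommGroup E] [NormedSpace ℂ E]

lemma const (c : E) : StripBounded fun _ => c :=
  ⟨differentiable_const c, ‖c‖, fun _ _ => le_rfl⟩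

lemma sum {ι : Type*} (s : Finset ι) {F : ι → ℂ → E} (h : ∀ i ∈ s, StripBounded (F i)) :
    StripBounded fun z => ∑ i ∈ s, F i z := by
  refine ⟨Differentiable.fun_sum fun i hi => (h i hi).differentiable, ?_⟩
  choose! B hB using fun i hi => (h i hi).bounded
  exact ⟨∑ i ∈ s, B i, fun z hz => norm_sum_le_of_le _ fun i hi => hB i hi z hz⟩

lemma smul {c : ℂ → ℂ} {F : ℂ → E} (hc : StripBounded c) (hF : StripBounded F) :
    StripBounded fun z => c z • F z := by
  obtain ⟨B, hB⟩ := hc.bounded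
  obtain ⟨B', hB'⟩ := hF.bounded
  refine ⟨hc.differentiable.smul hF.differentiable, B * B', fun z hz => ?_⟩
  rw [norm_smul]
  exact mul_le_mul (hB z hz) (hB' z hz) (norm_nonneg _) ((norm_nonneg _).trans (hB z hz))

lemma clm {E' : Type*} [NormedAddCommGroup E'] [NormedSpace ℂ E'] (ℓ : E →L[ℂ] E') {F : ℂ → E}
    (hF : StripBounded F) : StripBounded fun z => ℓ (F z) := by
  obtain ⟨B, hB⟩ := hF.bounded
  refine ⟨ℓ.differentiable.comp hF.differentiable, ‖ℓ‖ * B, fun z hz => ?_⟩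
  exact (ℓ.le_opNorm _).trans (mul_le_mul_of_nonneg_left (hB z hz) (norm_nonneg _))

lemma cpow {r : ℝ} (hr : 0 < r) (a b : ℝ) :
    StripBounded fun z : ℂ => (r : ℂ) ^ ((a : ℂ) + b * z) := by
  have hr' : (r : ℂ) ≠ 0 := by exact_mod_cast hr.ne'
  refine ⟨fun z => ?_, ?_⟩
  · refine DifferentiableAt.const_cpow (by fun_prop) (Or.inl hr')
  · have hc : ContinuousOn (fun x : ℝ => r ^ (a + b * x)) (Set.Icc 0 1) :=
      (continuous_const.rpow (by fun_prop) fun _ => Or.inl hr.ne').continuousOn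
    obtain ⟨B, hB⟩ := isCompact_Icc.exists_bound_of_continuousOn hc
    refine ⟨B, fun z hz => ?_⟩
    rw [Complex.norm_cpow_eq_rpow_re_of_pos hr]
    have := hB z.re hz
    simpa [Real.norm_of_nonneg (Real.rpow_nonneg hr.le _)] using (le_abs_self _).trans this

lemma three_lines {F : ℂ → E} (hF : StripBounded F) {A₀ A₁ : ℝ}
    (h0 : ∀ z : ℂ, z.re = 0 → ‖F z‖ ≤ A₀) (h1 : ∀ z : ℂ, z.re = 1 → ‖F z‖ ≤ A₁)
    {t : ℝ} (ht : t ∈ Set.Icc (0 : ℝ) 1) : ‖F t‖ ≤ A₀ ^ (1 - t) * A₁ ^ t := by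
  have := Complex.HadamardThreeLines.norm_le_interp_of_mem_verticalClosedStrip' (f := F)
    (z := (t : ℂ)) (a := A₀) (b := A₁) zero_lt_one
    (by simpa [Complex.HadamardThreeLines.verticalClosedStrip] using ht)
    hF.differentiable.diffContOnCl (by
      obtain ⟨B, hB⟩ := hF.bounded
      refine ⟨B, ?_⟩
      rintro _ ⟨z, hz, rfl⟩
      exact hB z hz) h0 h1
  simpa using this

end StripBounded

end Interpolation

/-! ### The three lines argument for an analytic family of operators. -/

section Interpolation

open scoped NNReal

variable {Ω : Type*} [MeasurableSpace Ω] {μ : Measure Ω}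
  {H : Type*} [NormedAddCommGroup H] [InnerProductSpace ℂ H] [IsFiniteMeasure μ]

/-- `φ^γ`, with value `0` where `φ = 0`. -/
noncomputable def nnPow (γ : ℂ) (r : ℝ≥0) : ℂ := if r = 0 then 0 else (r : ℂ) ^ γ

lemma enorm_nnPow_le (γ : ℂ) (r : ℝ≥0) : ‖nnPow γ r‖ₑ ≤ (r : ℝ≥0∞) ^ γ.re := by
  unfold nnPow
  split_ifs with h
  · simp
  · have h0 : (0 : ℝ) < r := by positivity
    rw [← ofReal_norm, show ((r : ℂ)) = ((r : ℝ) : ℂ) from rfl,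
      Complex.norm_cpow_eq_rpow_re_of_pos h0, ← ENNReal.ofReal_rpow_of_pos h0,
      ENNReal.ofReal_coe_nnreal]

lemma nnPow_ofReal {γ : ℝ} (hγ : γ ≠ 0) (r : ℝ≥0) : nnPow γ r = ((r : ℝ) ^ γ : ℝ) := by
  unfold nnPow
  split_ifs with h
  · simp [h, Real.zero_rpow hγ]
  · rw [Complex.ofReal_cpow r.coe_nonneg]

/-- This is what the convention at `r = 0` is for: `w ↦ 0 ^ w` is discontinuous at `w = 0`, whereas
the constant `0` is entire. -/
lemma stripBounded_nnPow (a b : ℝ) (r : ℝ≥0) :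
    StripBounded fun z : ℂ => nnPow ((a : ℂ) + b * z) r := by
  unfold nnPow
  split_ifs with h
  · exact .const 0
  · exact .cpow (r := r) (by positivity) a b

/-- Because `f` has finite range, the family is a finite sum of scalar exponentials times fixed
vectors of `L_1`, one for each value of `f`. -/
lemma stripBounded_powSimple (f : SimpleFunc Ω H) (a b : ℝ) :
    StripBounded fun z : ℂ => simpleLp μ (powSimple f ((a : ℂ) + b * z)) := by
  classical
  have key : ∀ z : ℂ, simpleLp μ (powSimple f ((a : ℂ) + b * z)) =
      ∑ v ∈ f.range, (if v = 0 then 0 else (‖v‖ : ℂ) ^ (((a - 1 : ℝ) : ℂ) + b * z)) •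
        weightedSimple μ f (Pi.single v 1) := by
    intro z
    have h1 : simpleLp μ (powSimple f ((a : ℂ) + b * z)) =
        weightedSimple μ f fun v => (‖v‖ : ℂ) ^ ((a : ℂ) + b * z - 1) := rfl
    rw [h1]
    simp_rw [← map_smul]
    rw [← map_sum]
    refine weightedSimple_congr f fun v hv => ?_
    by_cases h0 : v = 0
    · simp [h0]
    · congr 1
      rw [Finset.sum_apply, Finset.sum_eq_single v]
      · simp only [h0, if_false, Pi.smul_apply, Pi.single_eq_same, smul_eq_mul, mul_one]
        congr 1
        push_cast
        ring
      · intro u _ hu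
        simp [Pi.single_eq_of_ne (Ne.symm hu)]
      · exact fun h => absurd hv h
  simp_rw [key]
  refine .sum _ fun v _ => .smul ?_ (.const _)
  split_ifs with h
  · exact .const 0
  · exact .cpow (norm_pos_iff.2 h) _ b

/-- Three lines argument for an analytic family of operators, with a maximal function. -/
theorem lintegral_maximal_le_of_strip (R : Finset ℕ) (P : ℕ → ℂ → Lp H 1 μ →L[ℂ] Lp H 1 μ)
    (hP : ∀ N ∈ R, ∀ g : ℂ → Lp H 1 μ, StripBounded g → StripBounded fun z => P N z (g z))
    (f : SimpleFunc Ω H) (φ : SimpleFunc Ω ℝ≥0) (α₀ α₁ γ₀ γ₁ A₀ A₁ : ℝ)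
    (hA₀ : 0 ≤ A₀) (hA₁ : 0 ≤ A₁)
    (h0 : ∀ z : ℂ, z.re = 0 → ∫⁻ x, (φ x : ℝ≥0∞) ^ γ₀ *
      ⨆ N ∈ R, ‖P N z (simpleLp μ (powSimple f (α₀ + α₁ * z))) x‖ₑ ∂μ ≤ ENNReal.ofReal A₀)
    (h1 : ∀ z : ℂ, z.re = 1 → ∫⁻ x, (φ x : ℝ≥0∞) ^ (γ₀ + γ₁) *
      ⨆ N ∈ R, ‖P N z (simpleLp μ (powSimple f (α₀ + α₁ * z))) x‖ₑ ∂μ ≤ ENNReal.ofReal A₁)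
    {t : ℝ} (ht : t ∈ Set.Icc (0 : ℝ) 1) (hγ : 0 < γ₀ + γ₁ * t) :
    ∫⁻ x, (φ x : ℝ≥0∞) ^ (γ₀ + γ₁ * t) *
      ⨆ N ∈ R, ‖P N t (simpleLp μ (powSimple f (α₀ + α₁ * t))) x‖ₑ ∂μ ≤
        ENNReal.ofReal (A₀ ^ (1 - t) * A₁ ^ t) := by
  classical
  set g : ℂ → Lp H 1 μ := fun z => simpleLp μ (powSimple f (α₀ + α₁ * z)) with hg
  obtain ⟨s, m, hs, hs1, hsum, hm, hm0, hmsup, hin⟩ :=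
    exists_linearization R (fun N x => P N t (g t) x) fun N => Lp.stronglyMeasurable _
  have hind : ∀ N c, StronglyMeasurable ((φ ⁻¹' {c}).indicator (s N)) := fun N c =>
    (hs N).indicator (φ.measurableSet_fiber c)
  have hind1 : ∀ N c x, ‖(φ ⁻¹' {c}).indicator (s N) x‖ ≤ 1 := fun N c x =>
    (norm_indicator_le_norm_self _ _).trans (hs1 N x)
  -- The selectors `s N` are chosen at the parameter `t` and then frozen, so `F` is analytic. Since
  -- their norms add up to at most `1`, `F z` is dominated by the maximal integral for every `z`,
  -- with equality at `t`. Splitting over the values of `φ` makes the sum finite.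
  set F : ℂ → ℂ := fun z => ∑ N ∈ R, ∑ c ∈ φ.range, nnPow (γ₀ + γ₁ * z) c •
    pairing _ (hind N c) (hind1 N c) (P N z (g z)) with hF
  have hFS : StripBounded F := .sum _ fun N hN => .sum _ fun c _ =>
    .smul (stripBounded_nnPow _ _ _) (.clm _ (hP N hN _ (stripBounded_powSimple f _ _)))
  have hint : ∀ z N, Integrable
      (fun x => nnPow (γ₀ + γ₁ * z) (φ x) * inner ℂ (s N x) (P N z (g z) x)) μ := by
    intro z N
    have hb : Measurable fun x => nnPow (γ₀ + γ₁ * z) (φ x) :=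
      (φ.map (nnPow (γ₀ + γ₁ * z))).measurable
    obtain ⟨C, hC⟩ := (φ.map (nnPow (γ₀ + γ₁ * z))).exists_forall_norm_le
    exact (integrable_inner_Lp (hs N) (hs1 N) _).bdd_mul hb.aestronglyMeasurable
      (ae_of_all _ hC)
  have hFint : ∀ z, F z = ∫ x, ∑ N ∈ R,
      nnPow (γ₀ + γ₁ * z) (φ x) * inner ℂ (s N x) (P N z (g z) x) ∂μ := by
    intro z
    rw [integral_finsetSum _ fun N _ => hint z N]
    refine Finset.sum_congr rfl fun N _ => ?_
    simp_rw [pairing_apply, smul_eq_mul, ← integral_const_mul]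
    rw [← integral_finsetSum _ fun c _ =>
      (integrable_inner_Lp (hind N c) (hind1 N c) _).const_mul _]
    congr 1
    ext x
    rw [Finset.sum_eq_single (φ x)]
    · rw [Set.indicator_of_mem (by simp)]
    · intro c _ hc
      rw [Set.indicator_of_notMem (by simpa using hc.symm)]
      simp
    · exact fun h => absurd (φ.mem_range_self x) h
  have hFle : ∀ z, ‖F z‖ₑ ≤ ∫⁻ x, (φ x : ℝ≥0∞) ^ (γ₀ + γ₁ * z.re) *
      ⨆ N ∈ R, ‖P N z (g z) x‖ₑ ∂μ := by
    intro z
    rw [hFint]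
    refine (enorm_integral_le_lintegral_enorm _).trans (lintegral_mono fun x => ?_)
    have hre : ((γ₀ : ℂ) + γ₁ * z).re = γ₀ + γ₁ * z.re := by simp
    rw [← Finset.mul_sum, enorm_mul, ← hre]
    refine mul_le_mul' (enorm_nnPow_le _ _) ?_
    refine (enorm_sum_le _ _).trans ?_
    calc ∑ N ∈ R, ‖inner ℂ (s N x) (P N z (g z) x)‖ₑ
        ≤ ∑ N ∈ R, ‖s N x‖ₑ * ⨆ N ∈ R, ‖P N z (g z) x‖ₑ := by
          refine Finset.sum_le_sum fun N hN => ?_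
          refine le_trans ?_ (mul_le_mul' le_rfl
            (le_biSup (fun N => ‖P N z (g z) x‖ₑ) hN))
          rw [← ofReal_norm, ← ofReal_norm, ← ofReal_norm, ← ENNReal.ofReal_mul (norm_nonneg _)]
          exact ENNReal.ofReal_le_ofReal (norm_inner_le_norm _ _)
      _ ≤ _ := by
          rw [← Finset.sum_mul]
          exact mul_le_of_le_one_left zero_le (hsum x)
  have toReal : ∀ {w : ℂ} {A : ℝ}, 0 ≤ A → ‖w‖ₑ ≤ ENNReal.ofReal A → ‖w‖ ≤ A := by
    intro w A hA h
    rw [← ofReal_norm] at h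
    exact (ENNReal.ofReal_le_ofReal_iff hA).1 h
  have h3 := hFS.three_lines
    (fun z hz => toReal hA₀ ((hFle z).trans (by simpa [hz] using h0 z hz)))
    (fun z hz => toReal hA₁ ((hFle z).trans (by simpa [hz] using h1 z hz))) ht
  have hval : ∀ x, ∑ N ∈ R, nnPow (γ₀ + γ₁ * (t : ℂ)) (φ x) * inner ℂ (s N x) (P N t (g t) x) =
      (((φ x : ℝ) ^ (γ₀ + γ₁ * t) * m x : ℝ) : ℂ) := by
    intro x
    rw [← Finset.mul_sum, hin]
    have : (γ₀ : ℂ) + γ₁ * (t : ℂ) = ((γ₀ + γ₁ * t : ℝ) : ℂ) := by push_cast; rfl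
    rw [this, nnPow_ofReal hγ.ne', Complex.ofReal_mul]
  have hnn : ∀ x, 0 ≤ (φ x : ℝ) ^ (γ₀ + γ₁ * t) * m x := fun x =>
    mul_nonneg (Real.rpow_nonneg (φ x).coe_nonneg _) (hm0 x)
  have hFt := hFint t
  simp_rw [hval] at hFt
  rw [integral_complex_ofReal] at hFt
  have hI : Integrable (fun x => (φ x : ℝ) ^ (γ₀ + γ₁ * t) * m x) μ := by
    have := integrable_finsetSum R fun N _ => hint t N
    simp_rw [hval] at this
    simpa using this.re
  rw [hFt, Complex.norm_real, Real.norm_of_nonneg (integral_nonneg hnn)] at h3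
  refine le_trans (le_of_eq ?_) (ENNReal.ofReal_le_ofReal h3)
  rw [ofReal_integral_eq_lintegral_ofReal hI (ae_of_all _ hnn)]
  refine lintegral_congr fun x => ?_
  rw [← hmsup, ENNReal.ofReal_mul (Real.rpow_nonneg (φ x).coe_nonneg _)]
  congr 1
  rw [← ENNReal.ofReal_rpow_of_nonneg (φ x).coe_nonneg hγ.le, ENNReal.ofReal_coe_nnreal]

end Interpolation

/-! ### Stein interpolation for maximal functions of simple functions. -/

section Interpolation

open scoped NNReal

variable {Ω : Type*} [MeasurableSpace Ω] {μ : Measure Ω}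
  {H : Type*} [NormedAddCommGroup H] [InnerProductSpace ℂ H]

/-- The maximal function `max_{N ∈ R} ‖U_N f‖`. -/
noncomputable def maxFn (R : Finset ℕ) (U : ℕ → Lp H 1 μ →L[ℂ] Lp H 1 μ) (f : Lp H 1 μ)
    (x : Ω) : ℝ≥0∞ :=
  ⨆ N ∈ R, ‖U N f x‖ₑ

lemma measurable_maxFn (R : Finset ℕ) (U : ℕ → Lp H 1 μ →L[ℂ] Lp H 1 μ) (f : Lp H 1 μ) :
    Measurable (maxFn R U f) :=
  Measurable.biSup _ R.countable_toSet fun _ _ => (Lp.stronglyMeasurable _).enorm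

lemma lintegral_nnreal_simple_ne_top [IsFiniteMeasure μ] (φ : SimpleFunc Ω ℝ≥0) :
    ∫⁻ x, φ x ∂μ ≠ ∞ := by
  obtain ⟨C, hC⟩ := (φ.map fun r : ℝ≥0 => (r : ℝ)).exists_forall_norm_le
  refine ((lintegral_mono (g := fun _ => ENNReal.ofReal C) fun x => ?_).trans_lt ?_).ne
  · rw [← ENNReal.ofReal_coe_nnreal]
    refine ENNReal.ofReal_le_ofReal ((le_abs_self _).trans ?_)
    simpa using hC x
  · simpa using ENNReal.mul_lt_top ENNReal.ofReal_lt_top (measure_lt_top μ Set.univ)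

/-- Self-improvement of a bound on the simple functions below `M ^ p`. -/
lemma lintegral_rpow_le_of_simple [IsFiniteMeasure μ] {p : ℝ} (hp : 1 < p) {B Y : ℝ} (hB : 0 ≤ B)
    (hY : 0 ≤ Y) (M : Ω → ℝ≥0∞)
    (h : ∀ φ : SimpleFunc Ω ℝ≥0, (∀ x, (φ x : ℝ≥0∞) ≤ M x ^ p) →
      ∫⁻ x, (φ x : ℝ≥0∞) ^ (1 - 1 / p) * M x ∂μ ≤
        ENNReal.ofReal (B * (∫⁻ x, φ x ∂μ).toReal ^ (1 - 1 / p) * Y ^ (1 / p))) :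
    ∫⁻ x, M x ^ p ∂μ ≤ ENNReal.ofReal (B ^ p * Y) := by
  have hp0 : 0 < p := by linarith
  have hp1 : 0 < 1 - 1 / p := by
    rw [sub_pos, div_lt_one hp0]; exact hp
  rw [lintegral_eq_nnreal]
  refine iSup₂_le fun φ hφ => ?_
  have hint : (φ.map ((↑) : ℝ≥0 → ℝ≥0∞)).lintegral μ = ∫⁻ x, φ x ∂μ := by
    rw [← SimpleFunc.lintegral_eq_lintegral]
    rfl
  rw [hint]
  have hfin := lintegral_nnreal_simple_ne_top (μ := μ) φ
  set X := (∫⁻ x, φ x ∂μ).toReal with hX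
  have hX0 : 0 ≤ X := ENNReal.toReal_nonneg
  -- From `φ ≤ M^p` follows `φ^{1/p} ≤ M`, hence `X ≤ B X^{1-1/p} Y^{1/p}`. As `φ` is simple, `X` is
  -- finite and the power of `X` cancels.
  have h1 : ∫⁻ x, φ x ∂μ ≤ ∫⁻ x, (φ x : ℝ≥0∞) ^ (1 - 1 / p) * M x ∂μ := by
    refine lintegral_mono fun x => ?_
    have hφM : (φ x : ℝ≥0∞) ^ (1 / p) ≤ M x := by
      have := ENNReal.rpow_le_rpow (hφ x) (by positivity : 0 ≤ 1 / p)
      rwa [← ENNReal.rpow_mul, mul_one_div_cancel hp0.ne', ENNReal.rpow_one] at this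
    calc (φ x : ℝ≥0∞) = (φ x : ℝ≥0∞) ^ (1 - 1 / p) * (φ x : ℝ≥0∞) ^ (1 / p) := by
          rw [← ENNReal.rpow_add_of_nonneg _ _ hp1.le (by positivity), sub_add_cancel,
            ENNReal.rpow_one]
      _ ≤ _ := by gcongr
  have h2 := h1.trans (h φ hφ)
  rw [← ENNReal.ofReal_toReal hfin, ← hX] at h2 ⊢
  rw [ENNReal.toReal_ofReal hX0, ENNReal.ofReal_le_ofReal_iff (by positivity)] at h2
  refine ENNReal.ofReal_le_ofReal ?_
  rcases hX0.eq_or_lt with h0 | h0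
  · rw [← h0]
    positivity
  · have h3 : X ^ (1 / p) ≤ B * Y ^ (1 / p) := by
      have hpos : 0 < X ^ (1 - 1 / p) := Real.rpow_pos_of_pos h0 _
      refine le_of_mul_le_mul_left ?_ hpos
      rw [← Real.rpow_add h0, sub_add_cancel, Real.rpow_one]
      linarith
    have h4 := Real.rpow_le_rpow (by positivity) h3 hp0.le
    rwa [← Real.rpow_mul hX0, one_div_mul_cancel hp0.ne', Real.rpow_one,
      Real.mul_rpow hB (by positivity), ← Real.rpow_mul hY, one_div_mul_cancel hp0.ne',
      Real.rpow_one] at h4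

omit [InnerProductSpace ℂ H] in
lemma lintegral_simple_rpow_ne_top [IsFiniteMeasure μ] (f : SimpleFunc Ω H) {p : ℝ} (hp : 0 ≤ p) :
    ∫⁻ x, ‖f x‖ₑ ^ p ∂μ ≠ ∞ := by
  obtain ⟨C, hC⟩ := f.exists_forall_norm_le
  refine ((lintegral_mono (g := fun _ => ENNReal.ofReal C ^ p) fun x => ?_).trans_lt ?_).ne
  · refine ENNReal.rpow_le_rpow ?_ hp
    rw [← ofReal_norm]
    exact ENNReal.ofReal_le_ofReal (hC x)
  · simpa using ENNReal.mul_lt_top (ENNReal.rpow_lt_top_of_nonneg hp ENNReal.ofReal_ne_top)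
      (measure_lt_top μ Set.univ)

/-- Stein interpolation of a maximal function, on simple functions. The endpoint hypotheses are in
dual form. -/
theorem stein_simple [IsFiniteMeasure μ] (R : Finset ℕ) (P : ℕ → ℂ → Lp H 1 μ →L[ℂ] Lp H 1 μ)
    (hP : ∀ N ∈ R, ∀ g : ℂ → Lp H 1 μ, StripBounded g → StripBounded fun z => P N z (g z))
    {p t θ₀ θ₁ B₀ B₁ : ℝ} (hp : 1 < p) (ht : t ∈ Set.Icc (0 : ℝ) 1)
    (hθ₀ : θ₀ ∈ Set.Icc (0 : ℝ) 1) (hθ₁ : θ₁ ∈ Set.Icc (0 : ℝ) 1)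
    (hpt : 1 / p = (1 - t) * θ₀ + t * θ₁) (hB₀ : 0 ≤ B₀) (hB₁ : 0 ≤ B₁)
    (h0 : ∀ (f : SimpleFunc Ω H) (φ : SimpleFunc Ω ℝ≥0) (z : ℂ), z.re = 0 →
      ∀ α : ℂ, α.re = p * θ₀ →
      ∫⁻ x, (φ x : ℝ≥0∞) ^ (1 - θ₀) *
        maxFn R (fun N => P N z) (simpleLp μ (powSimple f α)) x ∂μ ≤
      ENNReal.ofReal B₀ * (∫⁻ x, φ x ∂μ) ^ (1 - θ₀) * (∫⁻ x, ‖f x‖ₑ ^ p ∂μ) ^ θ₀)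
    (h1 : ∀ (f : SimpleFunc Ω H) (φ : SimpleFunc Ω ℝ≥0) (z : ℂ), z.re = 1 →
      ∀ α : ℂ, α.re = p * θ₁ →
      ∫⁻ x, (φ x : ℝ≥0∞) ^ (1 - θ₁) *
        maxFn R (fun N => P N z) (simpleLp μ (powSimple f α)) x ∂μ ≤
      ENNReal.ofReal B₁ * (∫⁻ x, φ x ∂μ) ^ (1 - θ₁) * (∫⁻ x, ‖f x‖ₑ ^ p ∂μ) ^ θ₁)
    (f : SimpleFunc Ω H) :
    ∫⁻ x, maxFn R (fun N => P N t) (simpleLp μ f) x ^ p ∂μ ≤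
      ENNReal.ofReal (B₀ ^ (1 - t) * B₁ ^ t) ^ p * ∫⁻ x, ‖f x‖ₑ ^ p ∂μ := by
  have hp0 : 0 < p := by linarith
  have hp1 : 0 < 1 - 1 / p := by
    rw [sub_pos, div_lt_one hp0]; exact hp
  have hYfin := lintegral_simple_rpow_ne_top (μ := μ) f hp0.le
  set Y := (∫⁻ x, ‖f x‖ₑ ^ p ∂μ).toReal with hY
  have hY0 : 0 ≤ Y := ENNReal.toReal_nonneg
  have ht0 : 0 ≤ t := ht.1
  have ht1 : 0 ≤ 1 - t := sub_nonneg.2 ht.2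
  have hB : 0 ≤ B₀ ^ (1 - t) * B₁ ^ t := by positivity
  rw [← ENNReal.ofReal_toReal hYfin, ← hY, ENNReal.ofReal_rpow_of_nonneg hB hp0.le,
    ← ENNReal.ofReal_mul (by positivity)]
  refine lintegral_rpow_le_of_simple hp hB hY0 _ fun φ _ => ?_
  have hXfin := lintegral_nnreal_simple_ne_top (μ := μ) φ
  set X := (∫⁻ x, φ x ∂μ).toReal with hX
  have hX0 : 0 ≤ X := ENNReal.toReal_nonneg
  have conv : ∀ B θ : ℝ, 0 ≤ B → θ ∈ Set.Icc (0 : ℝ) 1 →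
      ENNReal.ofReal B * (∫⁻ x, φ x ∂μ) ^ (1 - θ) * (∫⁻ x, ‖f x‖ₑ ^ p ∂μ) ^ θ =
        ENNReal.ofReal (B * X ^ (1 - θ) * Y ^ θ) := by
    intro B θ hB hθ
    rw [← ENNReal.ofReal_toReal hYfin, ← hY, ← ENNReal.ofReal_toReal hXfin, ← hX,
      ENNReal.ofReal_rpow_of_nonneg hX0 (sub_nonneg.2 hθ.2),
      ENNReal.ofReal_rpow_of_nonneg hY0 hθ.1, ← ENNReal.ofReal_mul hB,
      ← ENNReal.ofReal_mul (by positivity)]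
  -- With `θ(z) = θ₀ + (θ₁ - θ₀) z`, the function is raised to the power `p θ(z)` and the test
  -- function to `1 - θ(z)`. Since `θ(t) = 1/p`, these are `f` itself and `φ^{1-1/p}` at `z = t`.
  have key := lintegral_maximal_le_of_strip R P hP f φ (p * θ₀) (p * (θ₁ - θ₀)) (1 - θ₀) (θ₀ - θ₁)
    (B₀ * X ^ (1 - θ₀) * Y ^ θ₀) (B₁ * X ^ (1 - θ₁) * Y ^ θ₁) (by positivity) (by positivity)
    (fun z hz => by
      rw [← conv _ _ hB₀ hθ₀]
      exact h0 f φ z hz _ (by simp [hz]))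
    (fun z hz => by
      rw [← conv _ _ hB₁ hθ₁, sub_add_sub_cancel]
      exact h1 f φ z hz _ (by simp [hz]; ring))
    ht (by rw [show 1 - θ₀ + (θ₀ - θ₁) * t = 1 - 1 / p by rw [hpt]; ring]; exact hp1)
  have hα : (((p * θ₀ : ℝ) : ℂ) + ((p * (θ₁ - θ₀) : ℝ) : ℂ) * t) = 1 := by
    have : p * θ₀ + p * (θ₁ - θ₀) * t = 1 := by
      have : p * (1 / p) = 1 := mul_one_div_cancel hp0.ne'
      rw [hpt] at this
      linarith
    exact_mod_cast this
  rw [hα, powSimple_one, show 1 - θ₀ + (θ₀ - θ₁) * t = 1 - 1 / p by rw [hpt]; ring] at key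
  refine key.trans (ENNReal.ofReal_le_ofReal (le_of_eq ?_))
  have hθ₀' : 0 ≤ 1 - θ₀ := sub_nonneg.2 hθ₀.2
  have hθ₁' : 0 ≤ 1 - θ₁ := sub_nonneg.2 hθ₁.2
  have e1 : X ^ (1 - 1 / p) = (X ^ (1 - θ₀)) ^ (1 - t) * (X ^ (1 - θ₁)) ^ t := by
    rw [← Real.rpow_mul hX0, ← Real.rpow_mul hX0, ← Real.rpow_add_of_nonneg hX0
      (by positivity) (by positivity)]
    congr 1
    rw [hpt]; ring
  have e2 : Y ^ (1 / p) = (Y ^ θ₀) ^ (1 - t) * (Y ^ θ₁) ^ t := by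
    rw [← Real.rpow_mul hY0, ← Real.rpow_mul hY0, ← Real.rpow_add_of_nonneg hY0
      (mul_nonneg hθ₀.1 ht1) (mul_nonneg hθ₁.1 ht0)]
    congr 1
    rw [hpt]; ring
  rw [e1, e2, Real.mul_rpow (by positivity) (by positivity),
    Real.mul_rpow (by positivity) (by positivity), Real.mul_rpow (by positivity) (by positivity),
    Real.mul_rpow (by positivity) (by positivity)]
  ring

end Interpolation

/-! ### Endpoint estimates in dual form. -/

section Endpoints

open scoped NNReal

variable {Ω : Type*} [MeasurableSpace Ω] {μ : Measure Ω} [IsFiniteMeasure μ]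
  {H : Type*} [NormedAddCommGroup H] [InnerProductSpace ℂ H]

lemma lintegral_powSimple_le (f : SimpleFunc Ω H) {α : ℂ} {p q : ℝ} (hq : 0 ≤ q)
    (hα : α.re * q = p) :
    ∫⁻ x, ‖simpleLp μ (powSimple f α) x‖ₑ ^ q ∂μ ≤ ∫⁻ x, ‖f x‖ₑ ^ p ∂μ := by
  refine lintegral_mono_ae ?_
  filter_upwards [coeFn_simpleLp (μ := μ) (powSimple f α)] with x hx
  rw [hx, ← hα, ENNReal.rpow_mul]
  exact ENNReal.rpow_le_rpow (enorm_powSimple_le f α x) hq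

omit [IsFiniteMeasure μ] in
-- Cauchy–Schwarz. The exponents are left as `1 - 1/2` to match the hypothesis of `stein_simple` at
-- `θ₀ = 1/2`.
lemma endpoint_two (φ : SimpleFunc Ω ℝ≥0) {M : Ω → ℝ≥0∞} (hM : Measurable M) {B Y : ℝ≥0∞}
    (h : ∫⁻ x, M x ^ (2 : ℝ) ∂μ ≤ B ^ (2 : ℝ) * Y) :
    ∫⁻ x, (φ x : ℝ≥0∞) ^ (1 - 1 / 2 : ℝ) * M x ∂μ ≤
      B * (∫⁻ x, φ x ∂μ) ^ (1 - 1 / 2 : ℝ) * Y ^ (1 / 2 : ℝ) := by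
  have hφ : Measurable fun x => (φ x : ℝ≥0∞) ^ (1 - 1 / 2 : ℝ) :=
    (φ.measurable.coe_nnreal_ennreal).pow_const _
  have := ENNReal.lintegral_mul_le_Lp_mul_Lq μ Real.HolderConjugate.two_two
    hφ.aemeasurable hM.aemeasurable
  refine this.trans ?_
  have e1 : ∀ x, ((φ x : ℝ≥0∞) ^ (1 - 1 / 2 : ℝ)) ^ (2 : ℝ) = φ x := fun x => by
    rw [← ENNReal.rpow_mul]; norm_num
  simp_rw [e1]
  rw [mul_comm B, mul_assoc]
  norm_num only
  refine mul_le_mul' le_rfl ?_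
  refine (ENNReal.rpow_le_rpow h (by norm_num)).trans (le_of_eq ?_)
  rw [ENNReal.mul_rpow_of_nonneg _ _ (by norm_num), ← ENNReal.rpow_mul]
  norm_num

end Endpoints

/-! ### Passage from simple functions to `L_p`, and contractivity of Dunford–Schwartz operators on
`L_2`. -/

section Extension

open scoped NNReal

variable {Ω : Type*} [MeasurableSpace Ω] {μ : Measure Ω}

lemma rpow_eLpNorm_eq_lintegral {E : Type*} [TopologicalSpace E] [ContinuousENorm E] {p : ℝ}
    (hp : 0 < p) (f : Ω → E) :
    eLpNorm f (ENNReal.ofReal p) μ ^ p = ∫⁻ x, ‖f x‖ₑ ^ p ∂μ := by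
  have h0 : ENNReal.ofReal p ≠ 0 := by simpa using hp
  rw [eLpNorm_eq_lintegral_rpow_enorm_toReal h0 ENNReal.ofReal_ne_top,
    ENNReal.toReal_ofReal hp.le, ← ENNReal.rpow_mul, one_div_mul_cancel hp.ne', ENNReal.rpow_one]

variable [IsProbabilityMeasure μ] {H : Type*} [NormedAddCommGroup H] [InnerProductSpace ℂ H]

omit [InnerProductSpace ℂ H] in
/-- Approximation of an element of `L_p ⊂ L_1` by simple functions. -/
lemma exists_simple_approx {p : ℝ} (hp : 1 ≤ p) (f : Lp H 1 μ)
    (hf : MemLp f (ENNReal.ofReal p) μ) {ε : ℝ≥0∞} (hε : ε ≠ 0) :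
    ∃ g : SimpleFunc Ω H, eLpNorm (f - simpleLp μ g : Lp H 1 μ) (ENNReal.ofReal p) μ ≤ ε ∧
      ‖f - simpleLp μ g‖ₑ ≤ ε := by
  obtain ⟨g, hg, _⟩ := hf.exists_simpleFunc_eLpNorm_sub_lt ENNReal.ofReal_ne_top hε
  have e : (f - simpleLp μ g : Lp H 1 μ) =ᵐ[μ] (f - ⇑g : Ω → H) := by
    filter_upwards [Lp.coeFn_sub f (simpleLp μ g), coeFn_simpleLp (μ := μ) g] with x h1 h2
    rw [h1, Pi.sub_apply, h2, Pi.sub_apply]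
  have h1 : eLpNorm (f - simpleLp μ g : Lp H 1 μ) (ENNReal.ofReal p) μ ≤ ε := by
    rw [eLpNorm_congr_ae e]
    exact hg.le
  refine ⟨g, h1, ?_⟩
  rw [Lp.enorm_def]
  refine (eLpNorm_le_eLpNorm_of_exponent_le ?_ (Lp.aestronglyMeasurable _)).trans h1
  simpa using hp

omit [IsProbabilityMeasure μ] in
lemma maxFn_le_add (R : Finset ℕ) (U : ℕ → Lp H 1 μ →L[ℂ] Lp H 1 μ) (f g : Lp H 1 μ) :
    ∀ᵐ x ∂μ, maxFn R U f x ≤ maxFn R U g x + ∑ N ∈ R, ‖U N (f - g) x‖ₑ := by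
  have h : ∀ᵐ x ∂μ, ∀ N ∈ R, U N (f - g) x = U N f x - U N g x := by
    refine (ae_ball_iff R.countable_toSet).2 fun N _ => ?_
    rw [map_sub]
    exact Lp.coeFn_sub _ _
  filter_upwards [h] with x hx
  refine iSup₂_le fun N hN => ?_
  have e : U N f x = U N g x + U N (f - g) x := by rw [hx N hN]; abel
  rw [e]
  refine (enorm_add_le _ _).trans (add_le_add (le_biSup (fun N => ‖U N g x‖ₑ) hN) ?_)
  exact Finset.single_le_sum (f := fun N => ‖U N (f - g) x‖ₑ) (fun _ _ => zero_le) hN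

/-- A maximal inequality on simple functions extends to `L_p`. -/
theorem maxFn_le_of_simple (R : Finset ℕ) (U : ℕ → Lp H 1 μ →L[ℂ] Lp H 1 μ) {p : ℝ} (hp : 1 ≤ p)
    {K : ℝ≥0∞} (hK : K ≠ ∞)
    (h : ∀ f : SimpleFunc Ω H, ∫⁻ x, maxFn R U (simpleLp μ f) x ^ p ∂μ ≤
      K * ∫⁻ x, ‖f x‖ₑ ^ p ∂μ)
    (f : Lp H 1 μ) (hf : MemLp f (ENNReal.ofReal p) μ) :
    ∫⁻ x, maxFn R U f x ^ p ∂μ ≤ K * ∫⁻ x, ‖f x‖ₑ ^ p ∂μ := by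
  have hp0 : 0 < p := by linarith
  set C : ℝ≥0∞ := ∑ N ∈ R, ‖U N‖ₑ + 1 with hC
  have hCtop : C ≠ ∞ := by simp [hC, ENNReal.sum_eq_top]
  have hC0 : C ≠ 0 := by simp [hC]
  -- The operators are bounded on `L_1` only, so the approximation is made close in `L_1` as well.
  -- Dividing by `C` makes the errors `r j` have integrals at most `2^{-j}`; they are summable,
  -- hence tend to `0` almost everywhere, and Fatou's lemma concludes.
  set ε : ℕ → ℝ≥0∞ := fun j => 2⁻¹ ^ j / C with hε
  have hε0 : ∀ j, ε j ≠ 0 := fun j => (ENNReal.div_pos (by simp) hCtop).ne'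
  choose g hg hg1 using fun j => exists_simple_approx hp f hf (hε0 j)
  have hsum : ∑' j : ℕ, (2⁻¹ : ℝ≥0∞) ^ j ≠ ∞ := by
    rw [ENNReal.tsum_geometric]
    simp
  have hεlim : Tendsto ε atTop (𝓝 0) := by
    have := ENNReal.Tendsto.div_const (b := C)
      (ENNReal.tendsto_atTop_zero_of_tsum_ne_top hsum) (Or.inr hC0)
    simpa using this
  set r : ℕ → Ω → ℝ≥0∞ := fun j x => ∑ N ∈ R, ‖U N (f - simpleLp μ (g j)) x‖ₑ with hr
  have hrm : ∀ j, Measurable (r j) := fun j =>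
    Finset.measurable_fun_sum _ fun N _ => (Lp.stronglyMeasurable _).enorm
  have hrint : ∀ j, ∫⁻ x, r j x ∂μ ≤ 2⁻¹ ^ j := by
    intro j
    rw [lintegral_finsetSum _ fun N _ => (Lp.stronglyMeasurable _).enorm]
    calc ∑ N ∈ R, ∫⁻ x, ‖U N (f - simpleLp μ (g j)) x‖ₑ ∂μ
        ≤ ∑ N ∈ R, ‖U N‖ₑ * ε j := by
          refine Finset.sum_le_sum fun N _ => ?_
          rw [← eLpNorm_one_eq_lintegral_enorm, ← Lp.enorm_def]
          exact ((U N).le_opENorm _).trans (mul_le_mul' le_rfl (hg1 j))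
      _ ≤ C * ε j := by
          rw [← Finset.sum_mul]
          exact mul_le_mul' le_self_add le_rfl
      _ = _ := ENNReal.mul_div_cancel hC0 hCtop
  have hrlim : ∀ᵐ x ∂μ, Tendsto (fun j => r j x) atTop (𝓝 0) := by
    have : ∫⁻ x, ∑' j, r j x ∂μ ≠ ∞ := by
      rw [lintegral_tsum fun j => (hrm j).aemeasurable]
      exact ne_top_of_le_ne_top hsum (ENNReal.tsum_le_tsum hrint)
    filter_upwards [ae_lt_top (.tsum hrm) this] with x hx
    exact ENNReal.tendsto_atTop_zero_of_tsum_ne_top hx.ne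
  have hMle : ∀ᵐ x ∂μ, maxFn R U f x ^ p ≤
      liminf (fun j => maxFn R U (simpleLp μ (g j)) x ^ p) atTop := by
    filter_upwards [ae_all_iff.2 fun j => maxFn_le_add R U f (simpleLp μ (g j)), hrlim]
      with x h1 h2
    have h3 : maxFn R U f x ≤ liminf (fun j => maxFn R U (simpleLp μ (g j)) x) atTop := by
      by_cases htop : maxFn R U f x = ∞
      · have hrfin : ∀ᶠ j in atTop, r j x < 1 := h2.eventually (gt_mem_nhds one_pos)
        rw [htop]
        refine le_liminf_of_le ?_ (hrfin.mono fun j hj => ?_)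
        · isBoundedDefault
        · have := h1 j
          rw [htop, top_le_iff, ENNReal.add_eq_top] at this
          exact (this.resolve_right (hj.trans ENNReal.one_lt_top).ne).ge
      · have h4 : Tendsto (fun j => maxFn R U f x - r j x) atTop (𝓝 (maxFn R U f x - 0)) :=
          ENNReal.Tendsto.sub tendsto_const_nhds h2 (Or.inl htop)
        rw [tsub_zero] at h4
        rw [← h4.liminf_eq]
        exact liminf_le_liminf (Eventually.of_forall fun j => tsub_le_iff_right.2 (h1 j))
    have h5 := (ENNReal.monotone_rpow_of_nonneg hp0.le).map_liminf_of_continuousAt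
      (F := atTop) (fun j => maxFn R U (simpleLp μ (g j)) x)
      (ENNReal.continuous_rpow_const.continuousAt)
    exact (ENNReal.rpow_le_rpow h3 hp0.le).trans h5.le
  have hgle : ∀ j, ∫⁻ x, ‖g j x‖ₑ ^ p ∂μ ≤ (eLpNorm f (ENNReal.ofReal p) μ + ε j) ^ p := by
    intro j
    rw [← rpow_eLpNorm_eq_lintegral hp0]
    refine ENNReal.rpow_le_rpow ?_ hp0.le
    have e : (g j : Ω → H) =ᵐ[μ] (f : Ω → H) - (f - simpleLp μ (g j) : Lp H 1 μ) := by
      filter_upwards [Lp.coeFn_sub f (simpleLp μ (g j)), coeFn_simpleLp (μ := μ) (g j)]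
        with x h1 h2
      rw [Pi.sub_apply, h1, Pi.sub_apply, h2, sub_sub_cancel]
    rw [eLpNorm_congr_ae e]
    exact (eLpNorm_sub_le (Lp.aestronglyMeasurable _) (Lp.aestronglyMeasurable _)
      (by simpa using hp)).trans (add_le_add le_rfl (hg j))
  have hlim : Tendsto (fun j => K * (eLpNorm f (ENNReal.ofReal p) μ + ε j) ^ p) atTop
      (𝓝 (K * (eLpNorm f (ENNReal.ofReal p) μ + 0) ^ p)) :=
    ENNReal.Tendsto.const_mul (((tendsto_const_nhds.add hεlim).ennrpow_const p)) (Or.inr hK)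
  rw [add_zero, rpow_eLpNorm_eq_lintegral hp0] at hlim
  calc ∫⁻ x, maxFn R U f x ^ p ∂μ
      ≤ ∫⁻ x, liminf (fun j => maxFn R U (simpleLp μ (g j)) x ^ p) atTop ∂μ :=
        lintegral_mono_ae hMle
    _ ≤ liminf (fun j => ∫⁻ x, maxFn R U (simpleLp μ (g j)) x ^ p ∂μ) atTop :=
        lintegral_liminf_le fun j => (measurable_maxFn _ _ _).pow_const _
    _ ≤ liminf (fun j => K * (eLpNorm f (ENNReal.ofReal p) μ + ε j) ^ p) atTop :=
        liminf_le_liminf (Eventually.of_forall fun j =>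
          (h (g j)).trans (mul_le_mul' le_rfl (hgle j)))
    _ = _ := hlim.liminf_eq

/-- A Dunford–Schwartz operator is a contraction in the norm of `L_2`. -/
theorem IsDunfordSchwartz.lintegral_sq_le {T : Lp H 1 μ →L[ℂ] Lp H 1 μ} (hT : IsDunfordSchwartz T)
    (f : Lp H 1 μ) (hf : MemLp f 2 μ) :
    ∫⁻ x, ‖T f x‖ₑ ^ (2 : ℝ) ∂μ ≤ ∫⁻ x, ‖f x‖ₑ ^ (2 : ℝ) ∂μ := by
  have hmax : ∀ g : Lp H 1 μ, ∀ x, maxFn {0} (fun _ => T) g x = ‖T g x‖ₑ := fun g x => by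
    simp [maxFn]
  have := maxFn_le_of_simple (μ := μ) {0} (fun _ => T) (one_le_two : (1 : ℝ) ≤ 2)
    ENNReal.one_ne_top (fun g => ?_) f (by simpa using hf)
  · simpa [hmax] using this
  -- The constant family reduces the interpolation theorem to Riesz–Thorin between `L_∞` (`θ₀ = 0`)
  -- and `L_1` (`θ₁ = 1`).
  have key := stein_simple (μ := μ) {0} (fun _ _ => T) (fun _ _ g hg => .clm T hg)
    (p := 2) (t := 1 / 2) (θ₀ := 0) (θ₁ := 1) (B₀ := 1) (B₁ := 1) one_lt_two
    (by norm_num) (by norm_num) (by norm_num) (by norm_num) zero_le_one zero_le_one ?_ ?_ g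
  · simpa using key
  · intro f φ z _ α hα
    simp only [hmax, sub_zero, ENNReal.rpow_one, ENNReal.rpow_zero, mul_one, ENNReal.ofReal_one,
      one_mul]
    have h1 : eLpNorm (simpleLp μ (powSimple f α)) ∞ μ ≤ 1 := by
      rw [eLpNorm_exponent_top]
      refine eLpNormEssSup_le_of_ae_enorm_bound ?_
      filter_upwards [coeFn_simpleLp (μ := μ) (powSimple f α)] with x hx
      rw [hx]
      refine (enorm_powSimple_le f α x).trans ?_
      simp [hα]
    have h2 := (hT.contraction_top _ ⟨Lp.aestronglyMeasurable _,
      h1.trans_lt ENNReal.one_lt_top⟩).trans h1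
    rw [eLpNorm_exponent_top] at h2
    refine lintegral_mono_ae ?_
    filter_upwards [ae_le_eLpNormEssSup (f := T (simpleLp μ (powSimple f α))) (μ := μ)] with x hx
    exact mul_le_of_le_one_right zero_le (hx.trans h2)
  · intro f φ z _ α hα
    simp only [hmax, sub_self, ENNReal.rpow_one, ENNReal.rpow_zero, mul_one, ENNReal.ofReal_one,
      one_mul]
    rw [← eLpNorm_one_eq_lintegral_enorm, ← Lp.enorm_def]
    have h1 : ‖T (simpleLp μ (powSimple f α))‖ₑ ≤ ‖simpleLp μ (powSimple f α)‖ₑ :=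
      enorm_le_iff_norm_le.2 (hT.contraction _)
    refine h1.trans ?_
    rw [Lp.enorm_def, eLpNorm_one_eq_lintegral_enorm]
    simpa using lintegral_powSimple_le (μ := μ) f (p := 2) (zero_le_one) (by rw [hα]; norm_num)

end Extension

/-! ### Von Neumann's inequality for Dunford–Schwartz operators on `L_2 ⊂ L_1`. -/

section VonNeumannLp

variable {Ω : Type*} [MeasurableSpace Ω] {μ : Measure Ω} [IsProbabilityMeasure μ]
  {H : Type*} [NormedAddCommGroup H] [InnerProductSpace ℂ H]

/-- The inclusion of `L_2` in `L_1`. -/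
noncomputable def inclL1 : Lp H 2 μ →ₗ[ℂ] Lp H 1 μ where
  toFun f := ⟨f.1, Lp.antitone one_le_two f.2⟩
  map_add' _ _ := rfl
  map_smul' _ _ := rfl

/-- The restriction to `L_2` of an operator on `L_1`. -/
noncomputable def restrictL2 (T : Lp H 1 μ →L[ℂ] Lp H 1 μ)
    (hT : ∀ f : Lp H 1 μ, MemLp f 2 μ → MemLp (T f) 2 μ) : Lp H 2 μ →ₗ[ℂ] Lp H 2 μ where
  toFun f := ⟨(T (inclL1 f)).1, Lp.mem_Lp_iff_memLp.2 (hT _ (Lp.memLp f))⟩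
  map_add' f g := by
    refine Subtype.ext ?_
    simp only [map_add]
    rfl
  map_smul' c f := by
    refine Subtype.ext ?_
    simp only [map_smul]
    rfl

lemma inclL1_restrictL2_pow (T : Lp H 1 μ →L[ℂ] Lp H 1 μ)
    (hT : ∀ f : Lp H 1 μ, MemLp f 2 μ → MemLp (T f) 2 μ) (k : ℕ) (f : Lp H 2 μ) :
    inclL1 ((restrictL2 T hT ^ k) f) = (T ^ k) (inclL1 f) := by
  induction k with
  | zero => simp
  | succ k ih =>
    rw [pow_succ', pow_succ', Module.End.mul_apply, mul_apply_eq_comp, ← ih]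
    rfl

omit [IsProbabilityMeasure μ] [InnerProductSpace ℂ H] in
lemma lintegral_enorm_sq_eq (f : Lp H 2 μ) :
    ∫⁻ x, ‖f x‖ₑ ^ (2 : ℝ) ∂μ = ENNReal.ofReal ‖f‖ ^ (2 : ℝ) := by
  rw [← rpow_eLpNorm_eq_lintegral two_pos, ofReal_norm, Lp.enorm_def]
  simp

/-- Von Neumann's inequality for a Dunford–Schwartz operator. -/
theorem IsDunfordSchwartz.von_neumann {T : Lp H 1 μ →L[ℂ] Lp H 1 μ} (hT : IsDunfordSchwartz T)
    (s : Finset ℕ) (c : ℕ → ℂ) (n : ℕ → ℕ) (Q : ℝ)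
    (hQ : ∀ z : ℂ, ‖z‖ = 1 → ‖∑ k ∈ s, c k * z ^ n k‖ ≤ Q) (f : Lp H 1 μ) (hf : MemLp f 2 μ) :
    ∫⁻ x, ‖(∑ k ∈ s, c k • (T ^ n k) f : Lp H 1 μ) x‖ₑ ^ (2 : ℝ) ∂μ ≤
      ENNReal.ofReal Q ^ (2 : ℝ) * ∫⁻ x, ‖f x‖ₑ ^ (2 : ℝ) ∂μ := by
  have hQ0 : 0 ≤ Q := (norm_nonneg _).trans (hQ 1 (by simp))
  have hmem : ∀ f : Lp H 1 μ, MemLp f 2 μ → MemLp (T f) 2 μ := by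
    intro f hf
    refine ⟨Lp.aestronglyMeasurable _, ?_⟩
    have h1 := hT.lintegral_sq_le f hf
    rw [← rpow_eLpNorm_eq_lintegral two_pos, ← rpow_eLpNorm_eq_lintegral two_pos,
      ENNReal.rpow_le_rpow_iff two_pos] at h1
    simp only [ENNReal.ofReal_ofNat] at h1
    exact h1.trans_lt hf.2
  have hcon : ∀ g : Lp H 2 μ, ‖restrictL2 T hmem g‖ ≤ ‖g‖ := by
    intro g
    have h1 : ∫⁻ x, ‖restrictL2 T hmem g x‖ₑ ^ (2 : ℝ) ∂μ ≤ ∫⁻ x, ‖g x‖ₑ ^ (2 : ℝ) ∂μ :=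
      hT.lintegral_sq_le (inclL1 g) (Lp.memLp g)
    rw [lintegral_enorm_sq_eq, lintegral_enorm_sq_eq, ENNReal.rpow_le_rpow_iff two_pos,
      ENNReal.ofReal_le_ofReal_iff (norm_nonneg _)] at h1
    exact h1
  set g : Lp H 2 μ := ⟨f.1, Lp.mem_Lp_iff_memLp.2 hf⟩ with hg
  have hgf : inclL1 g = f := rfl
  have h1 := ErgodicHilbert.von_neumann (restrictL2 T hmem) hcon s c n Q hQ g
  have h2 : inclL1 (∑ k ∈ s, c k • (restrictL2 T hmem ^ n k) g) = ∑ k ∈ s, c k • (T ^ n k) f := by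
    simp_rw [map_sum, map_smul, inclL1_restrictL2_pow, hgf]
  rw [← h2]
  have h3 := ENNReal.rpow_le_rpow (ENNReal.ofReal_le_ofReal h1) (zero_le_two (α := ℝ))
  rw [ENNReal.ofReal_mul hQ0, ENNReal.mul_rpow_of_nonneg _ _ zero_le_two,
    ← lintegral_enorm_sq_eq, ← lintegral_enorm_sq_eq] at h3
  exact h3

end VonNeumannLp

/-! ### Summation by parts and deterministic domination of weighted sums. -/

lemma abel_summation {E : Type*} [AddCommGroup E] [Module ℂ E] (d : ℕ → ℂ) (v : ℕ → E) {N : ℕ}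
    (hN : 1 ≤ N) :
    ∑ k ∈ Finset.Icc 1 N, d k • v k = d N • ∑ k ∈ Finset.Icc 1 N, v k +
      ∑ k ∈ Finset.Ico 1 N, (d k - d (k + 1)) • ∑ j ∈ Finset.Icc 1 k, v j := by
  induction N, hN using Nat.le_induction with
  | base => simp
  | succ N hN ih =>
    rw [Finset.sum_Icc_succ_top (by omega), ih, Finset.sum_Ico_succ_top hN,
      Finset.sum_Icc_succ_top (by omega)]
    module

section Deterministic

variable {E : Type*} [NormedAddCommGroup E] [NormedSpace ℂ E]

/-- Summation by parts against `1/W`, with `1/W_k - 1/W_{k+1}` written in the form that occurs in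
the variation hypothesis. -/
lemma norm_sum_div_le {W : ℕ → ℝ} (hW : MonotoneOn W (Set.Ici 1)) (hW1 : 1 ≤ W 1) (v : ℕ → E)
    {N : ℕ} (hN : 1 ≤ N) :
    ‖∑ k ∈ Finset.Icc 1 N, (W k : ℂ)⁻¹ • v k‖ ≤
      ‖∑ k ∈ Finset.Icc 1 N, v k‖ / W N +
      ∑ k ∈ Finset.Ico 1 N, 1 / W k * |1 - W k / W (k + 1)| * ‖∑ j ∈ Finset.Icc 1 k, v j‖ := by
  have hpos : ∀ k, 1 ≤ k → 0 < W k := fun k hk =>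
    zero_lt_one.trans_le (hW1.trans (hW (Set.mem_Ici.2 le_rfl) hk hk))
  rw [abel_summation _ _ hN]
  refine (norm_add_le _ _).trans (add_le_add (le_of_eq ?_) ?_)
  · rw [norm_smul, norm_inv, Complex.norm_real, Real.norm_of_nonneg (hpos N hN).le]
    ring
  · refine (norm_sum_le _ _).trans (Finset.sum_le_sum fun k hk => le_of_eq ?_)
    have hk1 := (Finset.mem_Ico.1 hk).1
    have h1 := hpos k hk1
    have h2 := hpos (k + 1) (by omega)
    rw [norm_smul]
    congr 1
    have : (W k : ℂ)⁻¹ - (W (k + 1) : ℂ)⁻¹ = ((1 / W k * (1 - W k / W (k + 1)) : ℝ) : ℂ) := by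
      have e : (W k)⁻¹ - (W (k + 1))⁻¹ = 1 / W k * (1 - W k / W (k + 1)) := by
        field_simp
      rw [← e]
      push_cast
      rfl
    rw [this, Complex.norm_real, Real.norm_eq_abs, abs_mul, abs_of_nonneg (by positivity)]

omit [NormedSpace ℂ E] in
-- If `m k ≤ N < m (k + 1)`, the sum up to `N` is the sum up to `m k` plus a piece of one block, and
-- `W N ≥ W (m k)`. Bounding a single term by the `ℓ_2` norm over all `k` gives a majorant
-- independent of `N`, where `k ≤ m k ≤ N < M`. The first sum covers `N < m 0`.
lemma norm_sum_div_le_block {W : ℕ → ℝ} (hW : MonotoneOn W (Set.Ici 1)) (hW1 : 1 ≤ W 1)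
    (v : ℕ → E) {m : ℕ → ℕ} (hm : StrictMono m) (hm0 : 1 ≤ m 0) {N : ℕ} (hN : 1 ≤ N)
    {M : ℕ} (hM : N < M) :
    ‖∑ k ∈ Finset.Icc 1 N, v k‖ / W N ≤ ∑ k ∈ Finset.Icc 1 (m 0), ‖v k‖ +
      √(∑ k ∈ Finset.range M, (‖∑ j ∈ Finset.Icc 1 (m k), v j‖ / W (m k)) ^ 2) +
      √(∑ k ∈ Finset.range M,
        ((∑ j ∈ Finset.Ioc (m k) (m (k + 1)), ‖v j‖) / W (m k)) ^ 2) := by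
  have hge : ∀ k, 1 ≤ k → 1 ≤ W k := fun k hk =>
    hW1.trans (hW (Set.mem_Ici.2 le_rfl) hk hk)
  have hs0 : 0 ≤ ∑ k ∈ Finset.Icc 1 (m 0), ‖v k‖ := Finset.sum_nonneg fun _ _ => norm_nonneg _
  by_cases hNm : N < m 0
  · have h1 : ‖∑ k ∈ Finset.Icc 1 N, v k‖ / W N ≤ ∑ k ∈ Finset.Icc 1 (m 0), ‖v k‖ := by
      refine (div_le_self (norm_nonneg _) (hge N hN)).trans ((norm_sum_le _ _).trans ?_)
      exact Finset.sum_le_sum_of_subset_of_nonneg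
        (Finset.Icc_subset_Icc le_rfl hNm.le) fun _ _ _ => norm_nonneg _
    have := Real.sqrt_nonneg
      (∑ k ∈ Finset.range M, (‖∑ j ∈ Finset.Icc 1 (m k), v j‖ / W (m k)) ^ 2)
    have := Real.sqrt_nonneg (∑ k ∈ Finset.range M,
      ((∑ j ∈ Finset.Ioc (m k) (m (k + 1)), ‖v j‖) / W (m k)) ^ 2)
    linarith
  · push Not at hNm
    obtain ⟨k, hk1, hk2⟩ : ∃ k, m k ≤ N ∧ N < m (k + 1) := by
      have hex : ∃ k, N < m (k + 1) := ⟨N, lt_of_lt_of_le (Nat.lt_succ_self N) (hm.id_le _)⟩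
      classical
      refine ⟨Nat.find hex, ?_, Nat.find_spec hex⟩
      rcases Nat.eq_zero_or_pos (Nat.find hex) with h0 | h0
      · rwa [h0]
      · have := Nat.find_min hex (Nat.sub_lt h0 one_pos)
        rw [Nat.sub_add_cancel (show 1 ≤ Nat.find hex from h0)] at this
        exact not_lt.1 this
    have hkM : k ∈ Finset.range M :=
      Finset.mem_range.2 ((hm.id_le k).trans hk1 |>.trans_lt hM)
    have hmk1 : 1 ≤ m k := hm0.trans (hm.monotone (Nat.zero_le k))
    have hWm : W (m k) ≤ W N := hW hmk1 hN hk1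
    have hWpos : 0 < W (m k) := zero_lt_one.trans_le (hge _ hmk1)
    have hsplit : ∑ j ∈ Finset.Icc 1 N, v j =
        ∑ j ∈ Finset.Icc 1 (m k), v j + ∑ j ∈ Finset.Ioc (m k) N, v j := by
      rw [← Finset.sum_union]
      · congr 1
        ext j
        simp only [Finset.mem_Icc, Finset.mem_union, Finset.mem_Ioc]
        omega
      · rw [Finset.disjoint_left]
        intro j hj hj'
        simp only [Finset.mem_Icc, Finset.mem_Ioc] at hj hj'
        omega
    have h1 : ‖∑ j ∈ Finset.Icc 1 N, v j‖ / W N ≤ ‖∑ j ∈ Finset.Icc 1 (m k), v j‖ / W (m k) +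
        (∑ j ∈ Finset.Ioc (m k) (m (k + 1)), ‖v j‖) / W (m k) := by
      rw [← add_div]
      refine div_le_div₀ (by positivity) ?_ hWpos hWm
      rw [hsplit]
      refine (norm_add_le _ _).trans (add_le_add le_rfl ((norm_sum_le _ _).trans ?_))
      exact Finset.sum_le_sum_of_subset_of_nonneg
        (Finset.Ioc_subset_Ioc le_rfl hk2.le) fun _ _ _ => norm_nonneg _
    have hsq : ∀ g : ℕ → ℝ, g k ≤ √(∑ k ∈ Finset.range M, g k ^ 2) := fun g =>
      Real.le_sqrt_of_sq_le
        (Finset.single_le_sum (f := fun k => g k ^ 2) (fun _ _ => sq_nonneg _) hkM)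
    have h2 := hsq fun k => ‖∑ j ∈ Finset.Icc 1 (m k), v j‖ / W (m k)
    have h3 := hsq fun k => (∑ j ∈ Finset.Ioc (m k) (m (k + 1)), ‖v j‖) / W (m k)
    linarith

end Deterministic

/-! ### Norms in `L_2` of sums and square functions. -/

section SquareFunction

variable {Ω : Type*} [MeasurableSpace Ω] {μ : Measure Ω}

lemma eLpNorm_sum_le_ofReal {ι : Type*} (s : Finset ι) {g : ι → Ω → ℝ} {c : ι → ℝ}
    (hg : ∀ i ∈ s, AEStronglyMeasurable (g i) μ) (hc : ∀ i ∈ s, 0 ≤ c i)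
    (h : ∀ i ∈ s, eLpNorm (g i) 2 μ ≤ ENNReal.ofReal (c i)) :
    eLpNorm (fun x => ∑ i ∈ s, g i x) 2 μ ≤ ENNReal.ofReal (∑ i ∈ s, c i) := by
  have e : (fun x => ∑ i ∈ s, g i x) = ∑ i ∈ s, g i := by
    ext x
    simp
  rw [e, ENNReal.ofReal_sum_of_nonneg hc]
  exact (eLpNorm_sum_le hg one_le_two).trans (Finset.sum_le_sum h)

/-- In `L_2` the square of the norm of a square function is the sum of the squared norms, so only
square-summability over the blocks is required. -/
lemma eLpNorm_sqrt_sum_sq_le {ι : Type*} (s : Finset ι) {g : ι → Ω → ℝ} {c : ι → ℝ}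
    (hg : ∀ i ∈ s, AEStronglyMeasurable (g i) μ) (hc : ∀ i ∈ s, 0 ≤ c i)
    (h : ∀ i ∈ s, eLpNorm (g i) 2 μ ≤ ENNReal.ofReal (c i)) :
    eLpNorm (fun x => √(∑ i ∈ s, g i x ^ 2)) 2 μ ≤ ENNReal.ofReal √(∑ i ∈ s, c i ^ 2) := by
  have two : ENNReal.ofReal 2 = 2 := by simp
  rw [← ENNReal.rpow_le_rpow_iff (two_pos : (0 : ℝ) < 2), ← two,
    rpow_eLpNorm_eq_lintegral two_pos]
  have e : ∀ x, ‖√(∑ i ∈ s, g i x ^ 2)‖ₑ ^ (2 : ℝ) = ∑ i ∈ s, ‖g i x‖ₑ ^ (2 : ℝ) := by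
    intro x
    have hnn : 0 ≤ ∑ i ∈ s, g i x ^ 2 := Finset.sum_nonneg fun _ _ => sq_nonneg _
    rw [← ofReal_norm, Real.norm_of_nonneg (Real.sqrt_nonneg _), ENNReal.rpow_two,
      ← ENNReal.ofReal_pow (Real.sqrt_nonneg _), Real.sq_sqrt hnn,
      ENNReal.ofReal_sum_of_nonneg fun _ _ => sq_nonneg _]
    refine Finset.sum_congr rfl fun i _ => ?_
    rw [ENNReal.rpow_two, ← ofReal_norm, ← ENNReal.ofReal_pow (norm_nonneg _), Real.norm_eq_abs,
      sq_abs]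
  simp_rw [e]
  rw [lintegral_finsetSum' _ fun i hi => (hg i hi).enorm.pow_const _]
  have hnn : 0 ≤ ∑ i ∈ s, c i ^ 2 := Finset.sum_nonneg fun _ _ => sq_nonneg _
  rw [ENNReal.rpow_two, ← ENNReal.ofReal_pow (Real.sqrt_nonneg _), Real.sq_sqrt hnn,
    ENNReal.ofReal_sum_of_nonneg fun _ _ => sq_nonneg _]
  refine Finset.sum_le_sum fun i hi => ?_
  rw [← rpow_eLpNorm_eq_lintegral two_pos, two, ENNReal.rpow_two, ENNReal.ofReal_pow (hc i hi)]
  exact pow_le_pow_left' (h i hi) 2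

lemma eLpNorm_const_mul_le_ofReal {g : Ω → ℝ} {r c : ℝ} (hr : 0 ≤ r)
    (h : eLpNorm g 2 μ ≤ ENNReal.ofReal c) :
    eLpNorm (fun x => r * g x) 2 μ ≤ ENNReal.ofReal (r * c) := by
  have e : (fun x => r * g x) = r • g := rfl
  rw [e, eLpNorm_const_smul, ENNReal.ofReal_mul hr, ← ofReal_norm, Real.norm_of_nonneg hr]
  exact mul_le_mul' le_rfl h

end SquareFunction

/-- Summable terms are eventually at most `1`, where squares lie below `p`-th powers. This converts
`p`-admissibility into what the square functions need. -/
lemma summable_rpow_two_of_summable_rpow {g : ℕ → ℝ} (hg : ∀ k, 0 ≤ g k) {p : ℝ} (hp0 : 0 < p)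
    (hp2 : p ≤ 2) (h : Summable fun k => g k ^ p) : Summable fun k => g k ^ 2 := by
  have h1 : ∀ᶠ k in cofinite, g k ^ p ≤ 1 :=
    (h.tendsto_cofinite_zero.eventually (ge_mem_nhds zero_lt_one))
  refine Summable.of_norm_bounded_eventually h (h1.mono fun k hk => ?_)
  have hg1 : g k ≤ 1 := by
    by_contra hlt
    push Not at hlt
    exact absurd hk (not_le.2 (Real.one_lt_rpow hlt hp0))
  rw [Real.norm_of_nonneg (sq_nonneg _)]
  rcases (hg k).eq_or_lt with h0 | h0
  · rw [← h0, Real.zero_rpow hp0.ne']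
    simp
  · rw [← Real.rpow_two]
    exact Real.rpow_le_rpow_of_exponent_ge h0 hg1 hp2

/-! ### The maximal inequality in `L_2`. -/

section MaximalL2

variable {Ω : Type*} [MeasurableSpace Ω] {μ : Measure Ω}
  {H : Type*} [NormedAddCommGroup H] [InnerProductSpace ℂ H]

/-- The operator `∑_{k=1}^N c_k T^{n_k}`. -/
noncomputable def powSum (T : Lp H 1 μ →L[ℂ] Lp H 1 μ) (n : ℕ → ℕ) (c : ℕ → ℂ) (N : ℕ) :
    Lp H 1 μ →L[ℂ] Lp H 1 μ :=
  ∑ k ∈ Finset.Icc 1 N, c k • T ^ n k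

lemma powSum_apply (T : Lp H 1 μ →L[ℂ] Lp H 1 μ) (n : ℕ → ℕ) (c : ℕ → ℂ) (N : ℕ) (f : Lp H 1 μ) :
    powSum T n c N f = ∑ k ∈ Finset.Icc 1 N, c k • (T ^ n k) f := by
  simp [powSum]

lemma coeFn_powSum (T : Lp H 1 μ →L[ℂ] Lp H 1 μ) (n : ℕ → ℕ) (c : ℕ → ℂ) (f : Lp H 1 μ) :
    ∀ᵐ x ∂μ, ∀ N, powSum T n c N f x = ∑ k ∈ Finset.Icc 1 N, c k • (T ^ n k) f x := by
  refine ae_all_iff.2 fun N => ?_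
  rw [powSum_apply]
  have h : ∀ᵐ x ∂μ, ∀ k, (c k • (T ^ n k) f : Lp H 1 μ) x = c k • (T ^ n k) f x :=
    ae_all_iff.2 fun k => Lp.coeFn_smul _ _
  filter_upwards [Lp.coeFn_finsetSum (Finset.Icc 1 N) fun k => (c k • (T ^ n k) f : Lp H 1 μ), h]
    with x h1 h2
  rw [h1, Finset.sum_apply]
  exact Finset.sum_congr rfl fun k _ => h2 k

variable [IsProbabilityMeasure μ]

lemma IsDunfordSchwartz.eLpNorm_powSum_le {T : Lp H 1 μ →L[ℂ] Lp H 1 μ} (hT : IsDunfordSchwartz T)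
    (n : ℕ → ℕ) (c : ℕ → ℂ) (N : ℕ) {Q : ℝ}
    (hQ : ∀ z : ℂ, ‖z‖ = 1 → ‖∑ k ∈ Finset.Icc 1 N, c k * z ^ n k‖ ≤ Q)
    (f : Lp H 1 μ) (hf : MemLp f 2 μ) :
    eLpNorm (fun x => ‖powSum T n c N f x‖) 2 μ ≤ ENNReal.ofReal (Q * (eLpNorm f 2 μ).toReal) := by
  have hQ0 : 0 ≤ Q := (norm_nonneg _).trans (hQ 1 (by simp))
  rw [eLpNorm_norm, ENNReal.ofReal_mul hQ0, ENNReal.ofReal_toReal hf.2.ne]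
  have h := hT.von_neumann _ c n Q hQ f hf
  rw [← powSum_apply, ← rpow_eLpNorm_eq_lintegral two_pos, ← rpow_eLpNorm_eq_lintegral two_pos,
    ← ENNReal.mul_rpow_of_nonneg _ _ zero_le_two, ENNReal.rpow_le_rpow_iff two_pos] at h
  simpa using h

lemma IsDunfordSchwartz.eLpNorm_pow_le {T : Lp H 1 μ →L[ℂ] Lp H 1 μ} (hT : IsDunfordSchwartz T)
    (k : ℕ) (f : Lp H 1 μ) (hf : MemLp f 2 μ) :
    eLpNorm (fun x => ‖(T ^ k) f x‖) 2 μ ≤ ENNReal.ofReal (eLpNorm f 2 μ).toReal := by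
  have h := hT.eLpNorm_powSum_le (fun _ => k) (fun _ => 1) 1 (Q := 1)
    (fun z hz => by simp [hz]) f hf
  simpa [powSum] using h

/-- The maximal inequality in `L_2`, with a constant depending on the weights only. -/
theorem exists_maximal_two {p : ℝ} (hp0 : 0 < p) (hp2 : p ≤ 2) {V W : ℕ → ℝ}
    (hV : ∀ k, 1 ≤ k → 0 ≤ V k) (hW : IsAdmissible p V W)
    (hvar : Summable fun k : ℕ => V (k + 1) / W (k + 1) * |1 - W (k + 1) / W (k + 2)|) :
    ∃ A : ℝ, 0 ≤ A ∧ ∀ (T : Lp H 1 μ →L[ℂ] Lp H 1 μ), IsDunfordSchwartz T →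
      ∀ (n : ℕ → ℕ) (b : ℕ → ℂ) (C Q : ℝ), 0 ≤ C → 0 ≤ Q → (∀ k, 1 ≤ k → ‖b k‖ ≤ C) →
      (∀ N, 1 ≤ N → ∀ z : ℂ, ‖z‖ = 1 → ‖∑ k ∈ Finset.Icc 1 N, b k * z ^ n k‖ ≤ Q * V N) →
      ∀ (R : Finset ℕ) (f : Lp H 1 μ), MemLp f 2 μ →
        ∫⁻ x, maxFn R (powSum T n fun k => (W k : ℂ)⁻¹ * b k) f x ^ (2 : ℝ) ∂μ ≤
          ENNReal.ofReal (A * (C + Q)) ^ (2 : ℝ) * ∫⁻ x, ‖f x‖ₑ ^ (2 : ℝ) ∂μ := by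
  obtain ⟨⟨hWm, hW1, -⟩, m, hm, hm0, hs1, hs2⟩ := hW
  have hge : ∀ k, 1 ≤ k → 1 ≤ W k := fun k hk => hW1.trans (hWm (Set.mem_Ici.2 le_rfl) hk hk)
  have hpos : ∀ k, 1 ≤ k → 0 < W k := fun k hk => zero_lt_one.trans_le (hge k hk)
  have hmk : ∀ k, 1 ≤ m k := fun k => hm0.trans (hm.monotone (Nat.zero_le k))
  have hr1 : ∀ k, 0 ≤ V (m k) / W (m k) := fun k => div_nonneg (hV _ (hmk k)) (hpos _ (hmk k)).le
  have hr2 : ∀ k, 0 ≤ ((m (k + 1) : ℝ) - m k) / W (m k) := fun k =>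
    div_nonneg (sub_nonneg.2 (by exact_mod_cast hm.monotone (Nat.le_succ k))) (hpos _ (hmk k)).le
  have hs1' := summable_rpow_two_of_summable_rpow hr1 hp0 hp2 hs1
  have hs2' := summable_rpow_two_of_summable_rpow hr2 hp0 hp2 hs2
  set σ₁ := ∑' k, (V (m k) / W (m k)) ^ 2
  set σ₂ := ∑' k, (((m (k + 1) : ℝ) - m k) / W (m k)) ^ 2
  set σ₃ := ∑' k : ℕ, V (k + 1) / W (k + 1) * |1 - W (k + 1) / W (k + 2)|
  have hterm : ∀ k, 0 ≤ V (k + 1) / W (k + 1) * |1 - W (k + 1) / W (k + 2)| := fun k =>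
    mul_nonneg (div_nonneg (hV _ (by omega)) (hpos _ (by omega)).le) (abs_nonneg _)
  have hσ₃ : 0 ≤ σ₃ := tsum_nonneg hterm
  -- The four terms come from the indices up to `m 0`, the block endpoints, the block interiors, and
  -- the summation by parts; they bound `D₀`, `D₁`, `D₂`, `D₃` below. The constant is fixed before
  -- `b`, so it will serve all `z` with `Re z = 0` at once.
  refine ⟨m 0 + √σ₁ + √σ₂ + σ₃, by positivity, ?_⟩
  intro T hT n b C Q hC hQ hb hpoly R f hf
  set ν := (eLpNorm f 2 μ).toReal with hν
  have hν0 : 0 ≤ ν := ENNReal.toReal_nonneg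
  set M := R.sup id + 1 with hM
  have hRM : ∀ N ∈ R, N < M := fun N hN => Nat.lt_succ_of_le (Finset.le_sup (f := id) hN)
  set u : ℕ → Ω → ℝ := fun j x => ‖(T ^ n j) f x‖ with hu
  set S : ℕ → Ω → ℝ := fun N x => ‖powSum T n b N f x‖ with hS
  have hum : ∀ j, AEStronglyMeasurable (u j) μ := fun j => (Lp.aestronglyMeasurable _).norm
  have hSm : ∀ j, AEStronglyMeasurable (S j) μ := fun j => (Lp.aestronglyMeasurable _).norm
  have hue : ∀ j, eLpNorm (u j) 2 μ ≤ ENNReal.ofReal ν := fun j => hT.eLpNorm_pow_le _ f hf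
  have hSe : ∀ N, 1 ≤ N → eLpNorm (S N) 2 μ ≤ ENNReal.ofReal (Q * V N * ν) := fun N hN =>
    hT.eLpNorm_powSum_le n b N (hpoly N hN) f hf
  set D₀ : Ω → ℝ := fun x => ∑ j ∈ Finset.Icc 1 (m 0), C * u j x
  set D₁ : Ω → ℝ := fun x => √(∑ k ∈ Finset.range M, ((W (m k))⁻¹ * S (m k) x) ^ 2)
  set D₂ : Ω → ℝ := fun x => √(∑ k ∈ Finset.range M,
    ((W (m k))⁻¹ * ∑ j ∈ Finset.Ioc (m k) (m (k + 1)), C * u j x) ^ 2)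
  set D₃ : Ω → ℝ := fun x => ∑ k ∈ Finset.range M,
    (1 / W (k + 1) * |1 - W (k + 1) / W (k + 2)|) * S (k + 1) x
  have hD₀ : eLpNorm D₀ 2 μ ≤ ENNReal.ofReal (m 0 * C * ν) := by
    refine (eLpNorm_sum_le_ofReal _ (c := fun _ => C * ν) (fun j _ => (hum j).const_mul C)
      (fun _ _ => by positivity) fun j _ => eLpNorm_const_mul_le_ofReal hC (hue j)).trans ?_
    simp [mul_assoc]
  have hD₁ : eLpNorm D₁ 2 μ ≤ ENNReal.ofReal (√σ₁ * Q * ν) := by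
    refine (eLpNorm_sqrt_sum_sq_le _ (c := fun k => (W (m k))⁻¹ * (Q * V (m k) * ν))
      (fun k _ => (hSm _).const_mul _)
      (fun k _ => mul_nonneg (inv_nonneg.2 (hpos _ (hmk k)).le)
        (mul_nonneg (mul_nonneg hQ (hV _ (hmk k))) hν0))
      fun k _ => eLpNorm_const_mul_le_ofReal (inv_nonneg.2 (hpos _ (hmk k)).le)
        (hSe _ (hmk k))).trans (ENNReal.ofReal_le_ofReal ?_)
    rw [mul_assoc]
    refine Real.sqrt_le_iff.2 ⟨by positivity, ?_⟩
    rw [mul_pow, Real.sq_sqrt (tsum_nonneg fun _ => sq_nonneg _)]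
    calc _ = (∑ k ∈ Finset.range M, (V (m k) / W (m k)) ^ 2) * (Q * ν) ^ 2 := by
          rw [Finset.sum_mul]
          refine Finset.sum_congr rfl fun k _ => ?_
          rw [div_eq_mul_inv]
          ring
      _ ≤ _ := by
          gcongr
          exact hs1'.sum_le_tsum _ fun _ _ => sq_nonneg _
  have hD₂ : eLpNorm D₂ 2 μ ≤ ENNReal.ofReal (√σ₂ * C * ν) := by
    refine (eLpNorm_sqrt_sum_sq_le _
      (c := fun k => (W (m k))⁻¹ * ∑ j ∈ Finset.Ioc (m k) (m (k + 1)), C * ν)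
      (fun k _ => AEStronglyMeasurable.const_mul (Finset.aestronglyMeasurable_fun_sum _
        fun j _ => (hum j).const_mul _) _)
      (fun k _ => mul_nonneg (inv_nonneg.2 (hpos _ (hmk k)).le) (by positivity))
      fun k _ => eLpNorm_const_mul_le_ofReal (inv_nonneg.2 (hpos _ (hmk k)).le)
        (eLpNorm_sum_le_ofReal _ (fun j _ => (hum j).const_mul C)
          (fun _ _ => by positivity) fun j _ => eLpNorm_const_mul_le_ofReal hC (hue j))).trans
      (ENNReal.ofReal_le_ofReal ?_)
    rw [mul_assoc]
    refine Real.sqrt_le_iff.2 ⟨by positivity, ?_⟩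
    rw [mul_pow, Real.sq_sqrt (tsum_nonneg fun _ => sq_nonneg _)]
    calc _ = (∑ k ∈ Finset.range M, (((m (k + 1) : ℝ) - m k) / W (m k)) ^ 2) * (C * ν) ^ 2 := by
          rw [Finset.sum_mul]
          refine Finset.sum_congr rfl fun k _ => ?_
          rw [Finset.sum_const, Nat.card_Ioc, nsmul_eq_mul,
            Nat.cast_sub (hm.monotone (Nat.le_succ k)), div_eq_mul_inv]
          ring
      _ ≤ _ := by
          gcongr
          exact hs2'.sum_le_tsum _ fun _ _ => sq_nonneg _
  have hD₃ : eLpNorm D₃ 2 μ ≤ ENNReal.ofReal (σ₃ * Q * ν) := by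
    have hw : ∀ k, 0 ≤ 1 / W (k + 1) * |1 - W (k + 1) / W (k + 2)| := fun k =>
      mul_nonneg (one_div_nonneg.2 (hpos _ (by omega)).le) (abs_nonneg _)
    refine (eLpNorm_sum_le_ofReal _
      (c := fun k => (1 / W (k + 1) * |1 - W (k + 1) / W (k + 2)|) * (Q * V (k + 1) * ν))
      (fun k _ => (hSm _).const_mul _)
      (fun k _ => mul_nonneg (hw k) (mul_nonneg (mul_nonneg hQ (hV _ (by omega))) hν0))
      fun k _ => eLpNorm_const_mul_le_ofReal (hw k) (hSe _ (by omega))).trans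
      (ENNReal.ofReal_le_ofReal ?_)
    rw [mul_assoc]
    calc _ = (∑ k ∈ Finset.range M, V (k + 1) / W (k + 1) * |1 - W (k + 1) / W (k + 2)|) *
          (Q * ν) := by
          rw [Finset.sum_mul]
          refine Finset.sum_congr rfl fun k _ => ?_
          ring
      _ ≤ _ := by
          gcongr
          exact hvar.sum_le_tsum _ fun k _ => hterm k
  have hD₀m : AEStronglyMeasurable D₀ μ :=
    Finset.aestronglyMeasurable_fun_sum _ fun j _ => (hum j).const_mul _
  have hD₁m : AEStronglyMeasurable D₁ μ := by
    refine (continuous_id.sqrt).comp_aestronglyMeasurable ?_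
    exact Finset.aestronglyMeasurable_fun_sum _ fun k _ => ((hSm _).const_mul _).pow 2
  have hD₂m : AEStronglyMeasurable D₂ μ := by
    refine (continuous_id.sqrt).comp_aestronglyMeasurable ?_
    exact Finset.aestronglyMeasurable_fun_sum _ fun k _ =>
      ((Finset.aestronglyMeasurable_fun_sum _ fun j _ => (hum j).const_mul _).const_mul _).pow 2
  have hD₃m : AEStronglyMeasurable D₃ μ :=
    Finset.aestronglyMeasurable_fun_sum _ fun k _ => (hSm _).const_mul _
  set D : Ω → ℝ := D₀ + D₁ + D₂ + D₃ with hD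
  have hDe : eLpNorm D 2 μ ≤ ENNReal.ofReal ((m 0 + √σ₁ + √σ₂ + σ₃) * (C + Q) * ν) := by
    calc eLpNorm D 2 μ ≤ eLpNorm D₀ 2 μ + eLpNorm D₁ 2 μ + eLpNorm D₂ 2 μ + eLpNorm D₃ 2 μ := by
          refine (eLpNorm_add_le ((hD₀m.add hD₁m).add hD₂m) hD₃m one_le_two).trans ?_
          refine add_le_add ?_ le_rfl
          refine (eLpNorm_add_le (hD₀m.add hD₁m) hD₂m one_le_two).trans ?_
          exact add_le_add (eLpNorm_add_le hD₀m hD₁m one_le_two) le_rfl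
      _ ≤ ENNReal.ofReal (m 0 * C * ν) + ENNReal.ofReal (√σ₁ * Q * ν) +
          ENNReal.ofReal (√σ₂ * C * ν) + ENNReal.ofReal (σ₃ * Q * ν) := by gcongr
      _ = ENNReal.ofReal (m 0 * C * ν + √σ₁ * Q * ν + √σ₂ * C * ν + σ₃ * Q * ν) := by
          rw [ENNReal.ofReal_add, ENNReal.ofReal_add, ENNReal.ofReal_add] <;> positivity
      _ ≤ _ := by
          refine ENNReal.ofReal_le_ofReal ?_
          have h1 : 0 ≤ (m 0 : ℝ) * Q * ν := by positivity
          have h2 : 0 ≤ √σ₁ * C * ν := by positivity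
          have h3 : 0 ≤ √σ₂ * Q * ν := by positivity
          have h4 : 0 ≤ σ₃ * C * ν := by positivity
          nlinarith
  have hmax : ∀ᵐ x ∂μ, maxFn R (powSum T n fun k => (W k : ℂ)⁻¹ * b k) f x ≤ ‖D x‖ₑ := by
    filter_upwards [coeFn_powSum T n (fun k => (W k : ℂ)⁻¹ * b k) f, coeFn_powSum T n b f]
      with x hx hx'
    refine iSup₂_le fun N hN => ?_
    rw [enorm_le_iff_norm_le, hx]
    refine le_trans ?_ (le_abs_self _)
    have hSx : ∀ N, ‖∑ k ∈ Finset.Icc 1 N, b k • (T ^ n k) f x‖ = S N x := fun N =>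
      (congrArg norm (hx' N)).symm
    have hnn : 0 ≤ D x := by
      simp only [hD, Pi.add_apply]
      have h0 : 0 ≤ D₀ x := Finset.sum_nonneg fun _ _ => mul_nonneg hC (norm_nonneg _)
      have h1 : 0 ≤ D₁ x := Real.sqrt_nonneg _
      have h2 : 0 ≤ D₂ x := Real.sqrt_nonneg _
      have h3 : 0 ≤ D₃ x := Finset.sum_nonneg fun k _ => mul_nonneg
        (mul_nonneg (one_div_nonneg.2 (hpos _ (by omega)).le) (abs_nonneg _)) (norm_nonneg _)
      positivity
    rcases Nat.eq_zero_or_pos N with h0 | hN1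
    · simpa [h0] using hnn
    · simp_rw [mul_smul]
      have hbu : ∀ k, 1 ≤ k → ‖b k • (T ^ n k) f x‖ ≤ C * u k x := fun k hk => by
        rw [norm_smul]
        exact mul_le_mul_of_nonneg_right (hb k hk) (norm_nonneg _)
      refine (norm_sum_div_le hWm hW1 (fun k => b k • (T ^ n k) f x) hN1).trans ?_
      rw [hD]
      simp only [Pi.add_apply]
      refine add_le_add ((norm_sum_div_le_block hWm hW1 _ hm hm0 hN1 (hRM N hN)).trans
        (add_le_add (add_le_add ?_ ?_) ?_)) ?_
      · exact Finset.sum_le_sum fun k hk => hbu k (Finset.mem_Icc.1 hk).1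
      · refine Real.sqrt_le_sqrt (Finset.sum_le_sum fun k _ => le_of_eq ?_)
        rw [hSx, div_eq_inv_mul]
      · refine Real.sqrt_le_sqrt (Finset.sum_le_sum fun k _ => ?_)
        rw [div_eq_inv_mul]
        have := (hpos _ (hmk k)).le
        gcongr with j hj
        exact hbu j ((hmk k).trans (Finset.mem_Ioc.1 hj).1.le)
      · simp_rw [hSx]
        rw [Finset.sum_Ico_eq_sum_range]
        calc _ ≤ ∑ k ∈ Finset.range (N - 1),
              (1 / W (k + 1) * |1 - W (k + 1) / W (k + 2)|) * S (k + 1) x :=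
              Finset.sum_le_sum fun k _ => by rw [add_comm 1 k]
          _ ≤ _ := Finset.sum_le_sum_of_subset_of_nonneg
              (Finset.range_mono (by have := hRM N hN; omega)) fun k _ _ => mul_nonneg
              (mul_nonneg (one_div_nonneg.2 (hpos _ (by omega)).le) (abs_nonneg _)) (norm_nonneg _)
  have two : ENNReal.ofReal 2 = 2 := by simp
  calc _ ≤ ∫⁻ x, ‖D x‖ₑ ^ (2 : ℝ) ∂μ :=
        lintegral_mono_ae (hmax.mono fun x hx => ENNReal.rpow_le_rpow hx zero_le_two)
    _ ≤ _ := by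
        rw [← rpow_eLpNorm_eq_lintegral two_pos, ← rpow_eLpNorm_eq_lintegral two_pos, two,
          ← ENNReal.mul_rpow_of_nonneg _ _ zero_le_two]
        refine ENNReal.rpow_le_rpow (hDe.trans (le_of_eq ?_)) zero_le_two
        rw [ENNReal.ofReal_mul (by positivity), hν, ENNReal.ofReal_toReal hf.2.ne]

end MaximalL2

/-! ### Banach's principle. -/

section BanachPrinciple

variable {Ω : Type*} [MeasurableSpace Ω] {μ : Measure Ω}
  {H : Type*} [NormedAddCommGroup H] [InnerProductSpace ℂ H]

/-- The maximal function over all indices obeys the uniform bound for finitely many indices. -/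
lemma lintegral_iSup_rpow_le (U : ℕ → Lp H 1 μ →L[ℂ] Lp H 1 μ) (f : Lp H 1 μ) {p : ℝ} (hp : 0 < p)
    {K : ℝ≥0∞} (h : ∀ R, ∫⁻ x, maxFn R U f x ^ p ∂μ ≤ K) :
    ∫⁻ x, (⨆ N, ‖U N f x‖ₑ) ^ p ∂μ ≤ K := by
  have e : ∀ x, (⨆ N, ‖U N f x‖ₑ) ^ p = ⨆ M, maxFn (Finset.range M) U f x ^ p := by
    intro x
    have h1 : (⨆ N, ‖U N f x‖ₑ) = ⨆ M, maxFn (Finset.range M) U f x := by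
      refine le_antisymm (iSup_le fun N => ?_) (iSup_le fun M => iSup₂_le fun N _ =>
        le_iSup (fun N => ‖U N f x‖ₑ) N)
      refine le_trans ?_ (le_iSup _ (N + 1))
      exact le_biSup (fun N => ‖U N f x‖ₑ) (Finset.self_mem_range_succ N)
    rw [h1]
    exact (ENNReal.orderIsoRpow p hp).map_iSup _
  simp_rw [e]
  rw [lintegral_iSup (fun M => (measurable_maxFn _ _ _).pow_const _)]
  · exact iSup_le fun M => h _
  · intro M M' hM x
    refine ENNReal.rpow_le_rpow ?_ hp.le
    exact biSup_mono fun N hN => Finset.range_mono hM hN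

variable [IsProbabilityMeasure μ]

/-- Banach's principle: with a maximal inequality, almost everywhere convergence need only be
checked on simple functions. -/
theorem ae_cauchySeq_of_maximal (U : ℕ → Lp H 1 μ →L[ℂ] Lp H 1 μ) {p : ℝ} (hp : 1 ≤ p) {K : ℝ≥0∞}
    (hK : K ≠ ∞)
    (hmax : ∀ f : Lp H 1 μ, MemLp f (ENNReal.ofReal p) μ → ∀ R,
      ∫⁻ x, maxFn R U f x ^ p ∂μ ≤ K * ∫⁻ x, ‖f x‖ₑ ^ p ∂μ)
    (hsimple : ∀ g : SimpleFunc Ω H, ∀ᵐ x ∂μ, CauchySeq fun N => U N (simpleLp μ g) x)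
    (f : Lp H 1 μ) (hf : MemLp f (ENNReal.ofReal p) μ) :
    ∀ᵐ x ∂μ, CauchySeq fun N => U N f x := by
  have hp0 : 0 < p := by linarith
  have hε0 : ∀ j : ℕ, (2⁻¹ : ℝ≥0∞) ^ j ≠ 0 := fun j => by simp
  choose g hg _ using fun j => exists_simple_approx hp f hf (hε0 j)
  have hmem : ∀ j, MemLp (f - simpleLp μ (g j) : Lp H 1 μ) (ENNReal.ofReal p) μ := fun j =>
    ⟨Lp.aestronglyMeasurable _, (hg j).trans_lt (ENNReal.pow_lt_top (by simp))⟩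
  -- The maximal inequality makes the integrals of `F j` at most `K 2^{-j}`, so `F j → 0` almost
  -- everywhere. One `g j` is then uniformly close in `N`, and an `ε/3` argument finishes.
  set F : ℕ → Ω → ℝ≥0∞ := fun j x => (⨆ N, ‖U N (f - simpleLp μ (g j)) x‖ₑ) ^ p with hF
  have hFm : ∀ j, Measurable (F j) := fun j =>
    (Measurable.iSup fun N => (Lp.stronglyMeasurable _).enorm).pow_const _
  have hFint : ∀ j, ∫⁻ x, F j x ∂μ ≤ K * 2⁻¹ ^ j := by
    intro j
    refine (lintegral_iSup_rpow_le U _ hp0 fun R => hmax _ (hmem j) R).trans ?_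
    refine mul_le_mul' le_rfl ?_
    rw [← rpow_eLpNorm_eq_lintegral hp0]
    refine (ENNReal.rpow_le_rpow (hg j) hp0.le).trans ?_
    refine (ENNReal.rpow_le_rpow_of_exponent_ge ?_ hp).trans (ENNReal.rpow_one _).le
    exact pow_le_one' (by simp) j
  have hsum : ∫⁻ x, ∑' j, F j x ∂μ ≠ ∞ := by
    rw [lintegral_tsum fun j => (hFm j).aemeasurable]
    refine ne_top_of_le_ne_top ?_ (ENNReal.tsum_le_tsum hFint)
    rw [ENNReal.tsum_mul_left, ENNReal.tsum_geometric]
    exact ENNReal.mul_ne_top hK (by simp)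
  have hsub : ∀ᵐ x ∂μ, ∀ j N,
      U N (f - simpleLp μ (g j)) x = U N f x - U N (simpleLp μ (g j)) x := by
    refine ae_all_iff.2 fun j => ae_all_iff.2 fun N => ?_
    rw [map_sub]
    exact Lp.coeFn_sub _ _
  filter_upwards [ae_lt_top (.tsum hFm) hsum, ae_all_iff.2 fun j => hsimple (g j), hsub]
    with x hx hc hs
  have hlim := ENNReal.tendsto_atTop_zero_of_tsum_ne_top hx.ne
  rw [Metric.cauchySeq_iff']
  intro ε hε
  have hε3 : 0 < ENNReal.ofReal (ε / 3) ^ p :=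
    ENNReal.rpow_pos (ENNReal.ofReal_pos.2 (by positivity)) ENNReal.ofReal_ne_top
  obtain ⟨j, hj⟩ := (hlim.eventually (gt_mem_nhds hε3)).exists
  have hj' : ∀ N, ‖U N f x - U N (simpleLp μ (g j)) x‖ < ε / 3 := by
    intro N
    have h1 := (ENNReal.rpow_lt_rpow_iff hp0).1 hj
    have h2 := (le_iSup (fun N => ‖U N (f - simpleLp μ (g j)) x‖ₑ) N).trans_lt h1
    rw [hs, ← ofReal_norm] at h2
    exact (ENNReal.ofReal_lt_ofReal_iff (by positivity)).1 h2
  obtain ⟨N₀, hN₀⟩ := Metric.cauchySeq_iff'.1 (hc j) (ε / 3) (by positivity)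
  refine ⟨N₀, fun N hN => ?_⟩
  have h1 := hN₀ N hN
  rw [dist_eq_norm] at h1 ⊢
  calc ‖U N f x - U N₀ f x‖ = ‖(U N f x - U N (simpleLp μ (g j)) x) +
        (U N (simpleLp μ (g j)) x - U N₀ (simpleLp μ (g j)) x) -
        (U N₀ f x - U N₀ (simpleLp μ (g j)) x)‖ := by congr 1; abel
    _ ≤ ‖U N f x - U N (simpleLp μ (g j)) x‖ +
        ‖U N (simpleLp μ (g j)) x - U N₀ (simpleLp μ (g j)) x‖ +
        ‖U N₀ f x - U N₀ (simpleLp μ (g j)) x‖ :=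
      (norm_sub_le _ _).trans (add_le_add (norm_add_le _ _) le_rfl)
    _ < ε := by linarith [hj' N, hj' N₀]

end BanachPrinciple

/-! ### Modulation by imaginary powers and the damping factor. -/

section Coefficients

/-- Here `k^w = e^{i y log k}` with `y = Im w`, and `log (1 + 1/k) ≤ 1/k`. The factor `1/k` is the
origin of the sum `∑ G_k / k` in `G_{n,1}`. -/
lemma norm_cpow_sub_cpow_succ_le {w : ℂ} (hw : w.re = 0) {k : ℕ} (hk : 1 ≤ k) :
    ‖(k : ℂ) ^ w - ((k + 1 : ℕ) : ℂ) ^ w‖ ≤ ‖w‖ / k := by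
  have hk0 : (0 : ℝ) < k := by exact_mod_cast hk
  have hw' : w = (w.im : ℂ) * Complex.I := by
    apply Complex.ext <;> simp [hw]
  have hlog : ∀ m : ℕ, 1 ≤ m → (m : ℂ) ^ w = Complex.exp (Complex.I * (w.im * Real.log m : ℝ)) := by
    intro m hm
    rw [Complex.cpow_def_of_ne_zero (by exact_mod_cast (by omega : m ≠ 0)), ← Complex.natCast_log]
    nth_rw 1 [hw']
    push_cast
    ring_nf
  set d : ℝ := w.im * Real.log (k + 1 : ℕ) - w.im * Real.log k with hd
  have e : (k : ℂ) ^ w - ((k + 1 : ℕ) : ℂ) ^ w =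
      - ((k : ℂ) ^ w * (Complex.exp (Complex.I * d) - 1)) := by
    rw [mul_sub, mul_one, hlog k hk, hlog (k + 1) (by omega), ← Complex.exp_add, ← mul_add,
      ← Complex.ofReal_add, hd, add_sub_cancel]
    ring
  rw [e, norm_neg, norm_mul, Complex.norm_natCast_cpow_of_pos (by omega), hw, Real.rpow_zero,
    one_mul]
  refine (Real.norm_exp_I_mul_ofReal_sub_one_le).trans ?_
  have h1 : Real.log (k + 1 : ℕ) - Real.log k ≤ 1 / k := by
    rw [← Real.log_div (by positivity) (by positivity)]
    refine (Real.log_le_sub_one_of_pos (by positivity)).trans (le_of_eq ?_)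
    push_cast
    field_simp
    ring
  have h0 : 0 ≤ Real.log (k + 1 : ℕ) - Real.log k :=
    sub_nonneg.2 (Real.log_le_log hk0 (by exact_mod_cast Nat.le_succ k))
  rw [hd, ← mul_sub, norm_mul, Real.norm_of_nonneg h0, Real.norm_eq_abs, div_eq_mul_one_div]
  exact mul_le_mul (Complex.abs_im_le_norm w) h1 h0 (norm_nonneg _)

lemma IsWeight.one_le' {G : ℕ → ℝ} (hG : IsWeight G) {k : ℕ} (hk : 1 ≤ k) : 1 ≤ G k :=
  hG.one_le.trans (hG.monotone (Set.mem_Ici.2 le_rfl) hk hk)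

lemma modWeight_one (G : ℕ → ℝ) (N : ℕ) :
    modWeight G 1 N = G N + ∑ k ∈ Finset.Ico 1 N, G k / k := by
  simp [modWeight]

lemma IsWeight.modWeight_nonneg {G : ℕ → ℝ} (hG : IsWeight G) {k : ℕ} (hk : 1 ≤ k) :
    0 ≤ modWeight G 1 k := by
  rw [modWeight_one]
  refine add_nonneg (zero_le_one.trans (hG.one_le' hk)) (Finset.sum_nonneg fun j hj => ?_)
  exact div_nonneg (zero_le_one.trans (hG.one_le' (Finset.mem_Ico.1 hj).1)) (Nat.cast_nonneg _)

/-- Modulation by `k ^ w`, `Re w = 0`, of exponential sums bounded by `K G_N`. -/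
lemma norm_modulated_sum_le {G : ℕ → ℝ} (hG : IsWeight G) {v : ℕ → ℂ} {K : ℝ} (hK : 0 ≤ K)
    (hv : ∀ N, 1 ≤ N → ‖∑ k ∈ Finset.Icc 1 N, v k‖ ≤ K * G N) {w : ℂ} (hw : w.re = 0)
    {N : ℕ} (hN : 1 ≤ N) :
    ‖∑ k ∈ Finset.Icc 1 N, (k : ℂ) ^ w * v k‖ ≤ K * (1 + ‖w‖) * modWeight G 1 N := by
  have h := abel_summation (fun k : ℕ => (k : ℂ) ^ w) v hN
  simp only [smul_eq_mul] at h
  have hG0 : 0 ≤ G N := zero_le_one.trans (hG.one_le' hN)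
  have hs0 : 0 ≤ ∑ k ∈ Finset.Ico 1 N, G k / k := Finset.sum_nonneg fun j hj =>
    div_nonneg (zero_le_one.trans (hG.one_le' (Finset.mem_Ico.1 hj).1)) (Nat.cast_nonneg _)
  rw [h, modWeight_one]
  calc _ ≤ K * G N + ∑ k ∈ Finset.Ico 1 N, ‖w‖ / k * (K * G k) := by
        refine (norm_add_le _ _).trans (add_le_add ?_ ((norm_sum_le _ _).trans
          (Finset.sum_le_sum fun k hk => ?_)))
        · rw [norm_mul, Complex.norm_natCast_cpow_of_pos (by omega), hw, Real.rpow_zero, one_mul]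
          exact hv N hN
        · have hk1 := (Finset.mem_Ico.1 hk).1
          rw [norm_mul]
          exact mul_le_mul (norm_cpow_sub_cpow_succ_le hw hk1) (hv k hk1) (norm_nonneg _)
            (by positivity)
    _ = K * G N + K * ‖w‖ * ∑ k ∈ Finset.Ico 1 N, G k / k := by
        rw [Finset.mul_sum]
        congr 1
        refine Finset.sum_congr rfl fun k _ => ?_
        ring
    _ ≤ _ := by
        have h1 : 0 ≤ K * ‖w‖ * G N := by positivity
        have h2 : 0 ≤ K * ∑ k ∈ Finset.Ico 1 N, G k / k := by positivity
        nlinarith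

/-- This factor equals `1` at `z = r` and decays like `e^{-y²}` on vertical lines, which offsets the
linear growth in `y` of the modulated sums. -/
lemma StripBounded.exp_sq_sub (r : ℝ) :
    StripBounded fun z : ℂ => Complex.exp (z ^ 2 - (r : ℂ) ^ 2) := by
  refine ⟨by fun_prop, Real.exp 1, fun z hz => ?_⟩
  rw [Complex.norm_exp, Real.exp_le_exp]
  have : (z ^ 2 - (r : ℂ) ^ 2).re = z.re ^ 2 - z.im ^ 2 - r ^ 2 := by
    simp [pow_two]
  rw [this]
  nlinarith [hz.1, hz.2, sq_nonneg z.im, sq_nonneg r]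

lemma norm_exp_sq_sub_le (z : ℂ) (r : ℝ) :
    ‖Complex.exp (z ^ 2 - (r : ℂ) ^ 2)‖ ≤ Real.exp (z.re ^ 2) * Real.exp (-z.im ^ 2) := by
  rw [Complex.norm_exp, ← Real.exp_add, Real.exp_le_exp]
  have : (z ^ 2 - (r : ℂ) ^ 2).re = z.re ^ 2 - z.im ^ 2 - r ^ 2 := by
    simp [pow_two]
  rw [this]
  nlinarith [sq_nonneg r]

lemma exp_neg_sq_mul_abs_le (y : ℝ) : Real.exp (-y ^ 2) * |y| ≤ 1 := by
  have h1 : |y| ≤ Real.exp (y ^ 2) := by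
    refine le_trans ?_ (Real.add_one_le_exp _)
    nlinarith [sq_nonneg (|y| - 1), sq_abs y, abs_nonneg y]
  rw [Real.exp_neg, inv_mul_le_iff₀ (Real.exp_pos _), mul_one]
  exact h1

end Coefficients

/-! ### The maximal inequality in `L_p` and convergence on `L_2`. -/

section Main

variable {Ω : Type*} [MeasurableSpace Ω] {μ : Measure Ω} [IsProbabilityMeasure μ]
  {H : Type*} [NormedAddCommGroup H] [InnerProductSpace ℂ H]

omit [IsProbabilityMeasure μ] in
lemma powSum_congr (T : Lp H 1 μ →L[ℂ] Lp H 1 μ) (n : ℕ → ℕ) {c d : ℕ → ℂ}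
    (h : ∀ k, 1 ≤ k → c k = d k) (N : ℕ) : powSum T n c N = powSum T n d N :=
  Finset.sum_congr rfl fun k hk => by rw [h k (Finset.mem_Icc.1 hk).1]

omit [IsProbabilityMeasure μ] in
lemma IsDunfordSchwartz.enorm_pow_le {T : Lp H 1 μ →L[ℂ] Lp H 1 μ} (hT : IsDunfordSchwartz T)
    (k : ℕ) (f : Lp H 1 μ) : ‖(T ^ k) f‖ₑ ≤ ‖f‖ₑ := by
  induction k with
  | zero => simp
  | succ k ih =>
    rw [pow_succ']
    exact (enorm_le_iff_norm_le.2 (hT.contraction _)).trans ih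

omit [IsProbabilityMeasure μ] in
/-- The trivial maximal inequality in `L_1`. -/
lemma IsDunfordSchwartz.lintegral_maxFn_le {T : Lp H 1 μ →L[ℂ] Lp H 1 μ} (hT : IsDunfordSchwartz T)
    (n : ℕ → ℕ) {c : ℕ → ℂ} {d : ℕ → ℝ} (hd : ∀ k, 0 ≤ d k) (hds : Summable d)
    (hcd : ∀ k, ‖c (k + 1)‖ ≤ d k) (R : Finset ℕ) (f : Lp H 1 μ) :
    ∫⁻ x, maxFn R (powSum T n c) f x ∂μ ≤
      ENNReal.ofReal (∑' k, d k) * ∫⁻ x, ‖f x‖ₑ ∂μ := by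
  have h1 : ∀ᵐ x ∂μ, maxFn R (powSum T n c) f x ≤
      ∑' k, ENNReal.ofReal (d k) * ‖(T ^ n (k + 1)) f x‖ₑ := by
    filter_upwards [coeFn_powSum T n c f] with x hx
    refine iSup₂_le fun N _ => ?_
    rw [hx, ← Finset.Ico_add_one_right_eq_Icc, Finset.sum_Ico_eq_sum_range]
    refine (enorm_sum_le _ _).trans (le_trans ?_ (ENNReal.sum_le_tsum (Finset.range (N + 1 - 1))))
    refine Finset.sum_le_sum fun k _ => ?_
    rw [add_comm 1 k, enorm_smul]
    refine mul_le_mul' ?_ le_rfl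
    rw [← ofReal_norm]
    exact ENNReal.ofReal_le_ofReal (hcd k)
  refine (lintegral_mono_ae h1).trans ?_
  rw [lintegral_tsum fun k => ((Lp.stronglyMeasurable _).enorm.const_mul _).aemeasurable,
    ENNReal.ofReal_tsum_of_nonneg hd hds, ← ENNReal.tsum_mul_right]
  refine ENNReal.tsum_le_tsum fun k => ?_
  rw [lintegral_const_mul _ (Lp.stronglyMeasurable _).enorm]
  refine mul_le_mul' le_rfl ?_
  rw [← eLpNorm_one_eq_lintegral_enorm, ← Lp.enorm_def, ← eLpNorm_one_eq_lintegral_enorm,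
    ← Lp.enorm_def]
  exact hT.enorm_pow_le _ _

omit [InnerProductSpace ℂ H] in
lemma memLp_two_simpleLp (g : SimpleFunc Ω H) : MemLp (simpleLp μ g) 2 μ :=
  (memLp_congr_ae (coeFn_simpleLp g)).2 (g.memLp_of_isFiniteMeasure 2 μ)

/-- The maximal inequality in `L_p`. -/
theorem exists_maximal_Lp {p : ℝ} (hp1 : 1 < p) (hp2 : p < 2) {G : ℕ → ℝ} (hG : IsWeight G)
    {n : ℕ → ℕ} {a : ℕ → ℂ} {C K : ℝ} (hC : 0 ≤ C) (hK : 0 ≤ K) (ha : ∀ k, 1 ≤ k → ‖a k‖ ≤ C)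
    (hpoly : ∀ N, 1 ≤ N → ∀ z : ℂ, ‖z‖ = 1 → ‖∑ k ∈ Finset.Icc 1 N, a k * z ^ n k‖ ≤ K * G N)
    {W : ℕ → ℝ} (hW : IsAdmissible p (modWeight G 1) W)
    (hvar : Summable (fun k : ℕ =>
      modWeight G 1 (k + 1) / W (k + 1) * |1 - W (k + 1) / W (k + 2)|))
    {β : ℝ} (hβ : 0 < β)
    (hsum : Summable (fun k : ℕ => 1 / (((k + 1 : ℕ) : ℝ) ^ β * W (k + 1))))
    {T : Lp H 1 μ →L[ℂ] Lp H 1 μ} (hT : IsDunfordSchwartz T) :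
    ∃ B : ℝ≥0∞, B ≠ ∞ ∧ ∀ f : Lp H 1 μ, MemLp f (ENNReal.ofReal p) μ → ∀ R : Finset ℕ,
      ∫⁻ x, maxFn R (powSum T n fun k =>
        (W k : ℂ)⁻¹ * ((k : ℂ) ^ (((-β : ℝ) : ℂ) * ((2 - p) / p : ℝ)) * a k)) f x ^ p ∂μ ≤
          B * ∫⁻ x, ‖f x‖ₑ ^ p ∂μ := by
  have hp0 : 0 < p := by linarith
  set t : ℝ := (2 - p) / p with ht
  have ht0 : 0 ≤ t := div_nonneg (by linarith) hp0.le
  have ht1 : t ≤ 1 := by rw [ht, div_le_one hp0]; linarith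
  have hWpos : ∀ k, 1 ≤ k → 0 < W k := fun k hk => zero_lt_one.trans_le (hW.isWeight.one_le' hk)
  obtain ⟨A, hA, hmax2⟩ := exists_maximal_two (μ := μ) (H := H) hp0 hp2.le
    (fun k hk => hG.modWeight_nonneg hk) hW hvar
  set b : ℂ → ℕ → ℂ := fun z k =>
    Complex.exp (z ^ 2 - (t : ℂ) ^ 2) * ((k : ℂ) ^ (((-β : ℝ) : ℂ) * z) * a k) with hb
  set P : ℕ → ℂ → Lp H 1 μ →L[ℂ] Lp H 1 μ := fun N z =>
    powSum T n (fun k => (W k : ℂ)⁻¹ * b z k) N with hP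
  have hPS : ∀ N (g : ℂ → Lp H 1 μ), StripBounded g → StripBounded fun z => P N z (g z) := by
    intro N g hg
    simp only [hP, powSum_apply]
    refine .sum _ fun k hk => ?_
    have hk0 : (0 : ℝ) < k := by exact_mod_cast (Finset.mem_Icc.1 hk).1
    have hcpow : StripBounded fun z : ℂ => (k : ℂ) ^ (((-β : ℝ) : ℂ) * z) := by
      simpa using StripBounded.cpow hk0 0 (-β)
    exact .smul (.smul (.const _) (.smul (.exp_sq_sub t) (.smul hcpow (.const _)))) (.clm _ hg)
  set d : ℕ → ℝ := fun k => Real.exp 1 * C * (1 / (((k + 1 : ℕ) : ℝ) ^ β * W (k + 1))) with hd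
  have hd0 : ∀ k, 0 ≤ d k := fun k => by
    have := hWpos (k + 1) (by omega)
    positivity
  have hds : Summable d := hsum.mul_left _
  have hb1 : ∀ z : ℂ, z.re = 1 → ∀ k, ‖(W (k + 1) : ℂ)⁻¹ * b z (k + 1)‖ ≤ d k := by
    intro z hz k
    have hk0 : (0 : ℝ) < ((k + 1 : ℕ) : ℝ) := by positivity
    have hw := hWpos (k + 1) (by omega)
    have e1 : ‖Complex.exp (z ^ 2 - (t : ℂ) ^ 2)‖ ≤ Real.exp 1 := by
      refine (norm_exp_sq_sub_le z t).trans ?_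
      rw [hz, one_pow]
      refine mul_le_of_le_one_right (Real.exp_pos _).le (Real.exp_le_one_iff.2 ?_)
      nlinarith [sq_nonneg z.im]
    have e2 : ‖((k + 1 : ℕ) : ℂ) ^ (((-β : ℝ) : ℂ) * z)‖ = (((k + 1 : ℕ) : ℝ) ^ β)⁻¹ := by
      rw [Complex.norm_natCast_cpow_of_pos (by omega), Complex.re_ofReal_mul, hz, mul_one,
        Real.rpow_neg hk0.le]
    rw [hb, norm_mul, norm_mul, norm_mul, e2, norm_inv, Complex.norm_real,
      Real.norm_of_nonneg hw.le]
    calc _ ≤ (W (k + 1))⁻¹ * (Real.exp 1 * ((((k + 1 : ℕ) : ℝ) ^ β)⁻¹ * C)) := by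
          gcongr
          exact ha _ (by omega)
      _ = d k := by
          simp only [hd, one_div, mul_inv]
          ring
  have hb0 : ∀ z : ℂ, z.re = 0 → ∀ k, 1 ≤ k → ‖b z k‖ ≤ C := by
    intro z hz k hk
    have e1 : ‖Complex.exp (z ^ 2 - (t : ℂ) ^ 2)‖ ≤ 1 := by
      refine (norm_exp_sq_sub_le z t).trans ?_
      rw [hz, zero_pow two_ne_zero, Real.exp_zero, one_mul]
      refine Real.exp_le_one_iff.2 ?_
      nlinarith [sq_nonneg z.im]
    rw [hb, norm_mul, norm_mul, Complex.norm_natCast_cpow_of_pos (by omega),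
      Complex.re_ofReal_mul, hz, mul_zero, Real.rpow_zero, one_mul]
    exact (mul_le_of_le_one_left (norm_nonneg _) e1).trans (ha k hk)
  -- The constant comes from `e^{-y²} (1 + β|y|) ≤ 1 + β`; its independence of `y = Im z` is what
  -- the three lines theorem requires.
  have hb0poly : ∀ z : ℂ, z.re = 0 → ∀ N, 1 ≤ N → ∀ ζ : ℂ, ‖ζ‖ = 1 →
      ‖∑ k ∈ Finset.Icc 1 N, b z k * ζ ^ n k‖ ≤ K * (1 + β) * modWeight G 1 N := by
    intro z hz N hN ζ hζ
    have hw : (((-β : ℝ) : ℂ) * z).re = 0 := by rw [Complex.re_ofReal_mul, hz, mul_zero]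
    have e : ∑ k ∈ Finset.Icc 1 N, b z k * ζ ^ n k = Complex.exp (z ^ 2 - (t : ℂ) ^ 2) *
        ∑ k ∈ Finset.Icc 1 N, (k : ℂ) ^ (((-β : ℝ) : ℂ) * z) * (a k * ζ ^ n k) := by
      rw [Finset.mul_sum]
      refine Finset.sum_congr rfl fun k _ => ?_
      rw [hb]
      ring
    have hzn : ‖((-β : ℝ) : ℂ) * z‖ = β * |z.im| := by
      have : z = (z.im : ℂ) * Complex.I := by
        apply Complex.ext <;> simp [hz]
      rw [norm_mul, Complex.norm_real, norm_neg, Real.norm_of_nonneg hβ.le]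
      nth_rw 1 [this]
      rw [norm_mul, Complex.norm_I, mul_one, Complex.norm_real, Real.norm_eq_abs]
    have h1 := norm_modulated_sum_le hG hK (fun N hN => hpoly N hN ζ hζ) hw hN
    rw [hzn] at h1
    have h2 := norm_exp_sq_sub_le z t
    rw [hz, zero_pow two_ne_zero, Real.exp_zero, one_mul] at h2
    rw [e, norm_mul]
    have hV := hG.modWeight_nonneg hN
    have h3 := exp_neg_sq_mul_abs_le z.im
    have h4 : Real.exp (-z.im ^ 2) ≤ 1 := Real.exp_le_one_iff.2 (by nlinarith [sq_nonneg z.im])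
    calc _ ≤ Real.exp (-z.im ^ 2) * (K * (1 + β * |z.im|) * modWeight G 1 N) :=
          mul_le_mul h2 h1 (norm_nonneg _) (Real.exp_pos _).le
      _ = K * (Real.exp (-z.im ^ 2) + β * (Real.exp (-z.im ^ 2) * |z.im|)) *
          modWeight G 1 N := by ring
      _ ≤ K * (1 + β * 1) * modWeight G 1 N := by gcongr
      _ = _ := by ring
  set B₀ : ℝ := A * (C + K * (1 + β)) with hB₀
  set B₁ : ℝ := ∑' k, d k with hB₁
  have hB₀0 : 0 ≤ B₀ := by positivity
  have hB₁0 : 0 ≤ B₁ := tsum_nonneg hd0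
  refine ⟨ENNReal.ofReal (B₀ ^ (1 - t) * B₁ ^ t) ^ p,
    ENNReal.rpow_ne_top_of_nonneg hp0.le ENNReal.ofReal_ne_top, fun f hf R => ?_⟩
  refine maxFn_le_of_simple R _ hp1.le
    (ENNReal.rpow_ne_top_of_nonneg hp0.le ENNReal.ofReal_ne_top) (fun g => ?_) f hf
  -- The endpoints are `L_2` and `L_1`, and `1/p = (1-t)/2 + t` forces `t = (2-p)/p`.
  have key := stein_simple (μ := μ) R P (fun N _ => hPS N) (p := p) (t := t) (θ₀ := 1 / 2)
    (θ₁ := 1) hp1 ⟨ht0, ht1⟩ (by norm_num) (by norm_num) (by rw [ht]; field_simp; ring)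
    hB₀0 hB₁0 ?_ ?_ g
  · have hbt : ∀ N, P N t = powSum T n (fun k =>
        (W k : ℂ)⁻¹ * ((k : ℂ) ^ (((-β : ℝ) : ℂ) * (t : ℂ)) * a k)) N := by
      intro N
      simp [hP, hb]
    simpa only [hbt] using key
  · intro g φ z hz α hα
    refine endpoint_two φ (measurable_maxFn _ _ _) ?_
    refine (hmax2 T hT n (b z) C (K * (1 + β)) hC (by positivity) (hb0 z hz) (hb0poly z hz) R _
      (memLp_two_simpleLp _)).trans ?_
    refine mul_le_mul' le_rfl (lintegral_powSimple_le g zero_le_two ?_)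
    rw [hα]
    ring
  · intro g φ z hz α hα
    simp only [sub_self, ENNReal.rpow_zero, one_mul, mul_one, ENNReal.rpow_one]
    refine (hT.lintegral_maxFn_le n hd0 hds (hb1 z hz) R _).trans ?_
    refine mul_le_mul' le_rfl ?_
    simpa using lintegral_powSimple_le (μ := μ) g (p := p) zero_le_one (by rw [hα]; ring)

/-- Almost everywhere convergence on `L_2`, by Dirichlet's test. -/
theorem ae_cauchySeq_of_memLp_two {p : ℝ} (hp0 : 0 < p) (hp2 : p ≤ 2) {G : ℕ → ℝ} (hG : IsWeight G)
    {n : ℕ → ℕ} {a : ℕ → ℂ} {C K : ℝ} (hC : 0 ≤ C) (hK : 0 ≤ K) (ha : ∀ k, 1 ≤ k → ‖a k‖ ≤ C)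
    (hpoly : ∀ N, 1 ≤ N → ∀ z : ℂ, ‖z‖ = 1 → ‖∑ k ∈ Finset.Icc 1 N, a k * z ^ n k‖ ≤ K * G N)
    {W : ℕ → ℝ} (hW : IsAdmissible p (modWeight G 1) W)
    (hvar : Summable (fun k : ℕ =>
      modWeight G 1 (k + 1) / W (k + 1) * |1 - W (k + 1) / W (k + 2)|))
    {s : ℝ} (hs : 0 < s) {T : Lp H 1 μ →L[ℂ] Lp H 1 μ} (hT : IsDunfordSchwartz T)
    (f : Lp H 1 μ) (hf : MemLp f 2 μ) :
    ∀ᵐ x ∂μ, CauchySeq fun N =>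
      powSum T n (fun k => (((k : ℝ) ^ s)⁻¹ : ℝ) * ((W k : ℂ)⁻¹ * a k)) N f x := by
  obtain ⟨A, hA, hmax2⟩ := exists_maximal_two (μ := μ) (H := H) hp0 hp2
    (fun k hk => hG.modWeight_nonneg hk) hW hvar
  have hpoly' : ∀ N, 1 ≤ N → ∀ z : ℂ, ‖z‖ = 1 →
      ‖∑ k ∈ Finset.Icc 1 N, a k * z ^ n k‖ ≤ K * modWeight G 1 N := by
    intro N hN z hz
    have := norm_modulated_sum_le hG hK (fun N hN => hpoly N hN z hz) (w := 0) rfl hN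
    simpa using this
  have hbd := lintegral_iSup_rpow_le _ f two_pos
    fun R => hmax2 T hT n a C K hC hK ha hpoly' R f hf
  have hfin : ∫⁻ x, (⨆ N, ‖powSum T n (fun k => (W k : ℂ)⁻¹ * a k) N f x‖ₑ) ^ (2 : ℝ) ∂μ ≠ ∞ := by
    refine ne_top_of_le_ne_top (ENNReal.mul_ne_top
      (ENNReal.rpow_ne_top_of_nonneg zero_le_two ENNReal.ofReal_ne_top) ?_) hbd
    rw [← rpow_eLpNorm_eq_lintegral two_pos]
    exact ENNReal.rpow_ne_top_of_nonneg zero_le_two (by simpa using hf.2.ne)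
  have hmeas : Measurable fun x =>
      (⨆ N, ‖powSum T n (fun k => (W k : ℂ)⁻¹ * a k) N f x‖ₑ) ^ (2 : ℝ) :=
    (Measurable.iSup fun N => (Lp.stronglyMeasurable _).enorm).pow_const _
  filter_upwards [ae_lt_top hmeas hfin, coeFn_powSum T n (fun k => (W k : ℂ)⁻¹ * a k) f,
    coeFn_powSum T n (fun k => (((k : ℝ) ^ s)⁻¹ : ℝ) * ((W k : ℂ)⁻¹ * a k)) f] with x hx h1 h2
  have hx' : (⨆ N, ‖powSum T n (fun k => (W k : ℂ)⁻¹ * a k) N f x‖ₑ) ≠ ∞ := by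
    intro h
    rw [h, ENNReal.top_rpow_of_pos two_pos] at hx
    exact hx.ne rfl
  have hanti : Antitone fun i : ℕ => (((i + 1 : ℕ) : ℝ) ^ s)⁻¹ := by
    intro i j hij
    have : ((i + 1 : ℕ) : ℝ) ≤ ((j + 1 : ℕ) : ℝ) := by exact_mod_cast Nat.succ_le_succ hij
    exact inv_anti₀ (Real.rpow_pos_of_pos (by positivity) _)
      (Real.rpow_le_rpow (by positivity) this hs.le)
  have hzero : Tendsto (fun i : ℕ => (((i + 1 : ℕ) : ℝ) ^ s)⁻¹) atTop (𝓝 0) :=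
    (((tendsto_rpow_atTop hs).comp tendsto_natCast_atTop_atTop).comp
      (tendsto_add_atTop_nat 1)).inv_tendsto_atTop
  have hshift : ∀ (v : ℕ → H) N,
      ∑ k ∈ Finset.Icc 1 N, v k = ∑ k ∈ Finset.range N, v (k + 1) := by
    intro v N
    rw [← Finset.Ico_add_one_right_eq_Icc, Finset.sum_Ico_eq_sum_range]
    simp_rw [add_comm 1, Nat.add_sub_cancel]
  -- Dirichlet's test at a fixed `x`: the factors `k^{-s}` decrease to `0`, and the partial sums of
  -- `W_k⁻¹ a_k T^{n_k} f(x)` are bounded by their finite supremum.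
  have := hanti.cauchySeq_series_mul_of_tendsto_zero_of_bounded hzero
    (z := fun k => ((W (k + 1) : ℂ)⁻¹ * a (k + 1)) • (T ^ n (k + 1)) f x)
    (b := (⨆ N, ‖powSum T n (fun k => (W k : ℂ)⁻¹ * a k) N f x‖ₑ).toReal) (fun N => by
      rw [← hshift fun k => ((W k : ℂ)⁻¹ * a k) • (T ^ n k) f x, ← h1, ← toReal_enorm]
      exact ENNReal.toReal_mono hx' (le_iSup
        (fun N => ‖powSum T n (fun k => (W k : ℂ)⁻¹ * a k) N f x‖ₑ) N))
  refine (congrArg CauchySeq (funext fun N => ?_)).mp this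
  rw [h2, hshift]
  refine Finset.sum_congr rfl fun k _ => ?_
  exact (Complex.coe_smul _ _).symm.trans (smul_smul _ _ _)

end Main

end ErgodicHilbert

/-! ### Proof of the theorem. -/

theorem theorem4p7
    {Ω : Type*} [MeasurableSpace Ω] (μ : Measure Ω) [IsProbabilityMeasure μ]
    {H : Type*} [NormedAddCommGroup H] [InnerProductSpace ℂ H] [CompleteSpace H]
    (p : ℝ) (hp1 : 1 < p) (hp2 : p < 2)
    (G : ℕ → ℝ) (hG : ErgodicHilbert.IsWeight G)
    (n : ℕ → ℕ) (hn : MonotoneOn n (Set.Ici 1))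
    (a : ℕ → ℂ) (ha : ∃ C : ℝ, ∀ k : ℕ, 1 ≤ k → ‖a k‖ ≤ C)
    (hpoly : ∃ K : ℝ, ∀ N : ℕ, 1 ≤ N → ∀ z : ℂ, ‖z‖ = 1 →
      ‖(1 / (G N : ℂ)) * ∑ k ∈ Finset.Icc 1 N, a k * z ^ n k‖ ≤ K)
    (W : ℕ → ℝ) (hW : ErgodicHilbert.IsAdmissible p (ErgodicHilbert.modWeight G 1) W)
    (hvar : Summable (fun k : ℕ =>
      ErgodicHilbert.modWeight G 1 (k + 1) / W (k + 1) * |1 - W (k + 1) / W (k + 2)|))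
    (β : ℝ) (hβ : 0 < β)
    (hsum : Summable (fun k : ℕ => 1 / (((k + 1 : ℕ) : ℝ) ^ β * W (k + 1))))
    (T : Lp H 1 μ →L[ℂ] Lp H 1 μ) (hT : ErgodicHilbert.IsDunfordSchwartz T)
    -- an element of `L_p(μ, H)`, which lies in `L_1(μ, H)` since `μ` is a probability measure
    (f : Lp H 1 μ) (hf : MemLp f (ENNReal.ofReal p) μ) :
    let t : ℝ := (2 - p) / p
    let S : ℕ → Ω → H :=
      ErgodicHilbert.hilbertSum a (fun k => (k : ℝ) ^ (β * t) * W k) n T f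
    (∀ᵐ x ∂μ, ∃ l : H, Tendsto (fun N => S N x) atTop (𝓝 l)) ∧
      MemLp (fun x => ⨆ N : ℕ, ‖S N x‖ₑ) (ENNReal.ofReal p) μ := by
  open ErgodicHilbert in
  intro t S
  have hp0 : 0 < p := by linarith
  have ht0 : 0 < t := div_pos (by linarith) hp0
  obtain ⟨C, hC⟩ := ha
  obtain ⟨K, hK⟩ := hpoly
  have hC0 : 0 ≤ C := (norm_nonneg _).trans (hC 1 le_rfl)
  have hK0 : 0 ≤ K := (norm_nonneg _).trans (hK 1 le_rfl 1 (by simp))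
  have hpoly : ∀ N, 1 ≤ N → ∀ z : ℂ, ‖z‖ = 1 →
      ‖∑ k ∈ Finset.Icc 1 N, a k * z ^ n k‖ ≤ K * G N := by
    intro N hN z hz
    have hGN : 0 < G N := zero_lt_one.trans_le (hG.one_le' hN)
    have := hK N hN z hz
    rwa [norm_mul, norm_div, norm_one, Complex.norm_real, Real.norm_of_nonneg hGN.le,
      one_div_mul_eq_div, div_le_iff₀ hGN] at this
  set c : ℕ → ℂ := fun k => a k / (((k : ℝ) ^ (β * t) * W k : ℝ) : ℂ) with hc
  have hc1 : ∀ k, 1 ≤ k → (W k : ℂ)⁻¹ * ((k : ℂ) ^ (((-β : ℝ) : ℂ) * (t : ℝ)) * a k) = c k := by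
    intro k hk
    have e : (k : ℂ) ^ (((-β : ℝ) : ℂ) * (t : ℝ)) = ((((k : ℝ) ^ (β * t))⁻¹ : ℝ) : ℂ) := by
      rw [← Real.rpow_neg (Nat.cast_nonneg k), Complex.ofReal_cpow (Nat.cast_nonneg k)]
      push_cast
      ring_nf
    rw [e, hc]
    push_cast
    rw [div_eq_mul_inv, mul_inv]
    ring
  have hc2 : ∀ k : ℕ, 1 ≤ k → (((k : ℝ) ^ (β * t))⁻¹ : ℝ) * ((W k : ℂ)⁻¹ * a k) = c k := by
    intro k hk
    rw [hc]
    push_cast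
    rw [div_eq_mul_inv, mul_inv]
    ring
  obtain ⟨B, hB, hmax⟩ := exists_maximal_Lp (μ := μ) hp1 hp2 hG hC0 hK0 hC hpoly hW hvar hβ hsum hT
  have hcN : (powSum T n fun k =>
      (W k : ℂ)⁻¹ * ((k : ℂ) ^ (((-β : ℝ) : ℂ) * ((2 - p) / p : ℝ)) * a k)) = powSum T n c :=
    funext (powSum_congr T n hc1)
  rw [hcN] at hmax
  have hS : ∀ᵐ x ∂μ, ∀ N, powSum T n c N f x = S N x := coeFn_powSum T n c f
  constructor
  -- Simple functions lie in `L_2`, and `p < 2` makes the exponent `βt` positive, as Dirichlet's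
  -- test needs.
  · have hcauchy := ae_cauchySeq_of_maximal (powSum T n c) hp1.le hB hmax (fun g => by
      have := ae_cauchySeq_of_memLp_two hp0 hp2.le hG hC0 hK0 hC hpoly hW hvar (mul_pos hβ ht0) hT
        _ (memLp_two_simpleLp g)
      simpa only [funext (powSum_congr T n hc2)] using this) f hf
    filter_upwards [hcauchy, hS] with x hx hSx
    simp_rw [hSx] at hx
    -- Completeness of `H` enters only here.
    exact cauchySeq_tendsto_of_complete hx
  · have hSm : ∀ N, StronglyMeasurable (S N) := fun N =>
      Finset.stronglyMeasurable_fun_sum _ fun k _ => (Lp.stronglyMeasurable _).const_smul _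
    refine ⟨(Measurable.iSup fun N => (hSm N).enorm).aestronglyMeasurable, ?_⟩
    rw [← ENNReal.rpow_lt_top_iff_of_pos hp0, rpow_eLpNorm_eq_lintegral hp0]
    have h1 := lintegral_iSup_rpow_le (powSum T n c) f hp0 fun R => hmax f hf R
    refine (lintegral_mono_ae ?_).trans_lt (h1.trans_lt (ENNReal.mul_lt_top hB.lt_top ?_))
    · filter_upwards [hS] with x hSx
      simp [hSx]
    · rw [← rpow_eLpNorm_eq_lintegral hp0]
      exact ENNReal.rpow_lt_top_of_nonneg hp0.le hf.2.ne
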